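/- Let $N>1$ and $m_i>1$ ($i\in\mathcal V=\{1,\dots,N\}$) be integers. Player $i$ has the dynamics $\dot x_i=A_ix_i+B_iu_i$, $y_i=C_ix_i$ with $x_i\in\mathbb R^{m_i}$, where $A_i$ has ones on the first superdiagonal and zeros elsewhere, $B_i=(0,\dots,0,1)^T$, $C_i=(1,0,\dots,0)$, and an objective function $f_i:\mathbb R^N\to\mathbb R$ of the action profile $\mathbf y=(y_1,\dots,y_N)^T$. Write $\nabla_if_i=\partial f_i/\partial y_i$. Assume: 1. each $f_i$ is continuously differentiable and there are $l_i>0$ with $|\nabla_if_i(\mathbf y)-\nabla_if_i(\mathbf z)|\le l_i\|\mathbf y-\mathbf z\|$ for all $\mathbf y,\mathbf z\in\mathbb R^N$; 2. there is $\omega>0$ with $\sum_{i=1}^N(y_i-z_i)(\nabla_if_i(\mathbf y)-\nabla_if_i(\mathbf z))\ge\omega\|\mathbf y-\mathbf z\|^2$ for all $\mathbf y,\mathbf z\in\mathbb R^N$; 3. the communication graph on $\mathcal V$ is undirected and connected, with weights $a_{ij}=a_{ji}$, $a_{ij}>0$ if $\{i,j\}$ is an edge and $a_{ij}=0$ otherwise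 (in particular $a_{ii}=0$). Fix $\theta_i\in(0,\tfrac12)$ and $\Delta_i>0$, and let $\phi_i(s)=\operatorname{sign}(s)\min\{|s|,\Delta_i\}$. Let $\bar A_i$ be the strictly upper triangular $m_i\times m_i$ matrix all of whose entries above the diagonal in column $k$ are $\theta_i^{m_i-k+1}$ ($2\le k\le m_i$), let $\bar B_i=(1,\dots,1)^T$, let $\mathbf R(A,B)=[B,AB,\dots,A^{m_i-1}B]$ denote the controllability matrix, $T_i=\mathbf R(A_i,B_i)\mathbf R(\bar A_i,\bar B_i)^{-1}$, and $x_i=T_i\bar x_i$. Consider the closed loop, for $t\ge 0$, $$u_i=-\sum_{k=1}^{m_i-1}\theta_i^k\,\phi_i(\bar x_{i(m_i-k+1)})-\theta_i^{m_i}\phi_i\Big(\bar x_{i1}+\prod_{k=1}^{m_i-1}\theta_i^k\int_0^t\nabla_if_i(\mathbf z_i(\tau))\,d\tau\Big),$$ $$\dot z_{ij}=-c_{ij}\xi_{ij},\qquad \dot c_{ij}=\xi_{ij}^2,\qquad \xi_{ij}=\sum_{k=1}^Na_{ik}(z_{ij}-z_{kj})+a_{ij}\Big(z_{ij}+\int_0^t\nabla_jf_j(\mathbf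 z_j(\tau))\,d\tau\Big),$$ where $\mathbf z_i=(z_{i1},\dots,z_{iN})^T$ and $c_{ij}(0)>0$ for all $i,j\in\mathcal V$. Then the game has a unique Nash equilibrium $\mathbf y^*$, that is, a unique $\mathbf y^*\in\mathbb R^N$ with $f_i(y_i^*,\mathbf y_{-i}^*)\le f_i(y_i,\mathbf y_{-i}^*)$ for all $i\in\mathcal V$ and $y_i\in\mathbb R$. For all initial values $x_i(0)$, $z_{ij}(0)$ and $c_{ij}(0)>0$ the closed loop has a solution on $[0,\infty)$. Every solution on $[0,\infty)$ satisfies $$\lim_{t\to\infty}\|\mathbf y(t)-\mathbf y^*\|=0,$$ and all the other variables, i.e. $x_i$, $\bar x_i$, $z_{ij}$, $c_{ij}$, $\xi_{ij}$, $\int_0^t\nabla_if_i(\mathbf z_i(\tau))\,d\tau$ and $u_i$ ($i,j\in\mathcal V$), stay bounded on $[0,\infty)$. -/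

import Mathlib

open Filter Topology

noncomputable section

namespace NashSeeking

/-! ### The game -/

/-- The partial derivative `∇ᵢ fᵢ (y) = ∂ fᵢ / ∂ yᵢ (y)` of the objective of player `i` with respect
to the player's own action (the objectives are assumed continuously differentiable below). -/
def ownGrad {N : ℕ} (f : Fin N → EuclideanSpace ℝ (Fin N) → ℝ) (i : Fin N)
    (y : EuclideanSpace ℝ (Fin N)) : ℝ :=
  fderiv ℝ (f i) y (EuclideanSpace.single i 1)

/-- The action profile in which player `i` plays `s` and all others play as in `y`. -/
def deviate {N : ℕ} (y : EuclideanSpace ℝ (Fin N)) (i : Fin N) (s : ℝ) :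
    EuclideanSpace ℝ (Fin N) :=
  WithLp.toLp 2 (Function.update (fun j => y j) i s)

/-- Nash equilibrium: no player can decrease its objective by a unilateral change of action. -/
def IsNashEquilibrium {N : ℕ} (f : Fin N → EuclideanSpace ℝ (Fin N) → ℝ)
    (y : EuclideanSpace ℝ (Fin N)) : Prop :=
  ∀ (i : Fin N) (s : ℝ), f i y ≤ f i (deviate y i s)

/-- The objectives are continuously differentiable and the partial derivatives `∇ᵢ fᵢ` are
globally Lipschitz. -/
def SmoothLipschitz {N : ℕ} (f : Fin N → EuclideanSpace ℝ (Fin N) → ℝ) : Prop :=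
  ∀ i : Fin N, ContDiff ℝ 1 (f i) ∧
    ∃ l : ℝ, 0 < l ∧ ∀ y z : EuclideanSpace ℝ (Fin N),
      |ownGrad f i y - ownGrad f i z| ≤ l * ‖y - z‖

/-- The pseudo-gradient `[∇ᵢ fᵢ]` is strongly monotone. -/
def StronglyMonotone {N : ℕ} (f : Fin N → EuclideanSpace ℝ (Fin N) → ℝ) : Prop :=
  ∃ ω : ℝ, 0 < ω ∧ ∀ y z : EuclideanSpace ℝ (Fin N),
    ω * ‖y - z‖ ^ 2 ≤ ∑ i, (y i - z i) * (ownGrad f i y - ownGrad f i z)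

/-! ### The communication graph -/

/-- `a` is a weighted adjacency matrix of the undirected graph `G`: symmetric, positive on edges,
zero otherwise (in particular on the diagonal). -/
structure IsWeightedAdjacency {N : ℕ} (G : SimpleGraph (Fin N))
    (a : Matrix (Fin N) (Fin N) ℝ) : Prop where
  symm : ∀ i j, a i j = a j i
  pos : ∀ i j, G.Adj i j → 0 < a i j
  zero : ∀ i j, ¬ G.Adj i j → a i j = 0

/-! ### High-order integrators and the linear transformation -/

/-- The matrix `A` of a chain of `m` integrators. -/
def chainA (m : ℕ) : Matrix (Fin m) (Fin m) ℝ :=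
  Matrix.of fun j k => if k.val = j.val + 1 then 1 else 0

/-- The input vector `B = (0, …, 0, 1)`. -/
def chainB (m : ℕ) : Fin m → ℝ := fun j => if j.val + 1 = m then 1 else 0

/-- The output vector `C = (1, 0, …, 0)`. -/
def chainC (m : ℕ) : Fin m → ℝ := fun j => if j.val = 0 then 1 else 0

/-- The matrix `Ā`: strictly upper triangular, every entry above the diagonal in the `k`-th column
(`k = 2, …, m`, counted from one) is `θ ^ (m - k + 1)`. -/
def barA (m : ℕ) (θ : ℝ) : Matrix (Fin m) (Fin m) ℝ :=
  Matrix.of fun j k => if j < k then θ ^ (m - k.val) else 0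

/-- The input vector `B̄ = (1, …, 1)`. -/
def barB (m : ℕ) : Fin m → ℝ := fun _ => 1

/-- The controllability matrix `[B, AB, …, A ^ (m - 1) B]`. -/
def controllability {m : ℕ} (A : Matrix (Fin m) (Fin m) ℝ) (B : Fin m → ℝ) :
    Matrix (Fin m) (Fin m) ℝ :=
  Matrix.of fun j k => (A ^ k.val).mulVec B j

/-- The transformation `T = R(A, B) R(Ā, B̄)⁻¹`. -/
def transT (m : ℕ) (θ : ℝ) : Matrix (Fin m) (Fin m) ℝ :=
  controllability (chainA m) (chainB m) * (controllability (barA m θ) (barB m))⁻¹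

/-! ### The controller -/

/-- The saturation function `φ(s) = sign(s) min(|s|, Δ)`. -/
def sat (Δ s : ℝ) : ℝ := Real.sign s * min |s| Δ

/-- The saturated control of one player of order `m`, as a function of the transformed state `xb`
and of `w = ∫₀ᵗ ∇ᵢ fᵢ (zᵢ)`:
`- ∑ₖ₌₁ᵐ⁻¹ θᵏ φ(x̄₍ₘ₋ₖ₊₁₎) - θᵐ φ(x̄₁ + (∏ₖ₌₁ᵐ⁻¹ θᵏ) w)`.
In the sum, the index is `k - 1`, and components of `xb` are counted from zero. -/
def satControl {m : ℕ} (hm : 1 < m) (θ Δ : ℝ) (xb : Fin m → ℝ) (w : ℝ) : ℝ :=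
  -(∑ k : Fin (m - 1), θ ^ (k.val + 1) * sat Δ (xb ⟨m - 1 - k.val, by omega⟩))
    - θ ^ m * sat Δ (xb ⟨0, by omega⟩ + (∏ k ∈ Finset.Icc 1 (m - 1), θ ^ k) * w)

/-- The time functions of the closed loop: states `x i t ∈ ℝ^(m i)`, estimates
`z i t = (z_{i1}(t), …, z_{iN}(t))` and adaptive gains `c i j t`. Only `t ≥ 0` matters. -/
structure Trajectory (N : ℕ) (m : Fin N → ℕ) where
  x : (i : Fin N) → ℝ → (Fin (m i) → ℝ)
  z : Fin N → ℝ → EuclideanSpace ℝ (Fin N)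
  c : Fin N → Fin N → ℝ → ℝ

namespace Trajectory

variable {N : ℕ} {m : Fin N → ℕ}

/-- The vector of actions, `yᵢ = C xᵢ`. -/
def y (p : Trajectory N m) (t : ℝ) : EuclideanSpace ℝ (Fin N) :=
  WithLp.toLp 2 fun i => chainC (m i) ⬝ᵥ p.x i t

/-- The transformed state, `xᵢ = Tᵢ x̄ᵢ`. -/
def xbar (p : Trajectory N m) (θ : Fin N → ℝ) (i : Fin N) (t : ℝ) : Fin (m i) → ℝ :=
  (transT (m i) (θ i))⁻¹.mulVec (p.x i t)

/-- The integral `∫₀ᵗ ∇ᵢ fᵢ (zᵢ(τ)) dτ`. -/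
def gradInt (p : Trajectory N m) (f : Fin N → EuclideanSpace ℝ (Fin N) → ℝ) (i : Fin N)
    (t : ℝ) : ℝ :=
  ∫ τ in (0 : ℝ)..t, ownGrad f i (p.z i τ)

/-- `ξᵢⱼ = ∑ₖ aᵢₖ (zᵢⱼ - zₖⱼ) + aᵢⱼ (zᵢⱼ + ∫₀ᵗ ∇ⱼ fⱼ (zⱼ(τ)) dτ)`. -/
def xi (p : Trajectory N m) (f : Fin N → EuclideanSpace ℝ (Fin N) → ℝ)
    (a : Matrix (Fin N) (Fin N) ℝ) (i j : Fin N) (t : ℝ) : ℝ :=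
  ∑ k, a i k * (p.z i t j - p.z k t j) + a i j * (p.z i t j + p.gradInt f j t)

/-- The control input of player `i`. -/
def u (p : Trajectory N m) (hm : ∀ i, 1 < m i) (f : Fin N → EuclideanSpace ℝ (Fin N) → ℝ)
    (θ Δ : Fin N → ℝ) (i : Fin N) (t : ℝ) : ℝ :=
  satControl (hm i) (θ i) (Δ i) (p.xbar θ i t) (p.gradInt f i t)

/-- `p` is a (classical) solution on `[0, ∞)` of the closed loop
`ẋᵢ = Aᵢ xᵢ + Bᵢ uᵢ`, `żᵢⱼ = -cᵢⱼ ξᵢⱼ`, `ċᵢⱼ = ξᵢⱼ²`, with `cᵢⱼ(0) > 0`. -/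
structure IsSolution (p : Trajectory N m) (hm : ∀ i, 1 < m i)
    (f : Fin N → EuclideanSpace ℝ (Fin N) → ℝ) (a : Matrix (Fin N) (Fin N) ℝ)
    (θ Δ : Fin N → ℝ) : Prop where
  state : ∀ (i : Fin N) (t : ℝ), 0 ≤ t →
    HasDerivWithinAt (p.x i)
      ((chainA (m i)).mulVec (p.x i t) + p.u hm f θ Δ i t • chainB (m i)) (Set.Ici 0) t
  estimate : ∀ (i j : Fin N) (t : ℝ), 0 ≤ t →
    HasDerivWithinAt (fun s => p.z i s j) (-(p.c i j t * p.xi f a i j t)) (Set.Ici 0) t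
  gain : ∀ (i j : Fin N) (t : ℝ), 0 ≤ t →
    HasDerivWithinAt (p.c i j) (p.xi f a i j t ^ 2) (Set.Ici 0) t
  gain_pos : ∀ i j : Fin N, 0 < p.c i j 0

end Trajectory

/-- A real function of time is bounded on `[0, ∞)`. -/
def BoundedInTime (g : ℝ → ℝ) : Prop := ∃ M : ℝ, ∀ t : ℝ, 0 ≤ t → |g t| ≤ M

end NashSeeking

end

namespace NashSeeking

open Set

/-! The closed loop is a cascade: the estimator, with state `w j = ∫ ∇ⱼfⱼ(zⱼ)`, `z`, `c`, does not
see the integrator chains, and it drives them only through `w`.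

Estimator. The errors `e i j = z i j + w j` measure how far each player's `z i` is from the common
profile `-w`, which performs approximate gradient play, and `ξ` is a grounded Laplacian applied to
`e`. With `V = ½|w + y*|² + ½ ∑ ξ e + ½ ∑ (c - g)²` the actual gains cancel from the derivative,
leaving `-g ∑ ξ²`. Since `e` is controlled by `ξ` on a connected graph (`exists_error_sq_le`),
strong monotonicity and a large fictitious gain `g` absorb all cross terms (`exists_lyapDeriv_le`).
Hence everything is bounded, and a Barbalat argument (`tendsto_zero_of_dissipation`) gives `w →
-y*`, `ξ → 0` and `z i → y*`.

Chains. `T` conjugates the chain to the pair `(Ā, B̄)`. Adding `P w`, `P = ∏ θᵏ`, to the first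
component turns the loop into a nested saturation cascade disturbed by `P ∇ᵢfᵢ(zᵢ) → 0`. As `θ <
1/2`, each feedback dominates those of all earlier components, so the saturations become inactive
from the last component backwards, and the components then vanish from the first one onwards
(`cascade_tendsto_zero`). So `x̄ → y*ᵢ P e₁`, and `T (P e₁) = e₁` gives `yᵢ → y*ᵢ`.

Existence. Only the estimator field fails to be globally Lipschitz. It is cut off outside a ball
containing the initial sublevel set of `V`; scaling by a nonnegative factor keeps `V` nonincreasing,
so the solution never meets the cutoff.

Equilibrium. Nash equilibria are the zeros of the pseudo-gradient; a gradient step is a contraction,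
and strong monotonicity gives uniqueness. -/

/-! ### Differential inequalities on the half-line -/

/-- A function with derivative at most `C` on an interval grows at most with slope `C`. -/
lemma sub_le_of_deriv_le {g g' : ℝ → ℝ}
    (hg : ∀ t, 0 ≤ t → HasDerivWithinAt g (g' t) (Ici 0) t) {a b C : ℝ} (ha : 0 ≤ a)
    (hab : a ≤ b) (h : ∀ t ∈ Ico a b, g' t ≤ C) : g b - g a ≤ C * (b - a) := by
  have key := image_le_of_deriv_right_le_deriv_boundary (f := g) (f' := g') (a := a) (b := b)
    (B := fun x => g a + C * (x - a)) (B' := fun _ => C)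
    (fun t ht => ((hg t (ha.trans ht.1)).continuousWithinAt).mono
      (fun s hs => ha.trans hs.1))
    (fun t ht => (hg t (ha.trans ht.1)).mono (fun s hs => (ha.trans ht.1).trans hs))
    (by simp) (by fun_prop)
    (fun t _ => by
      have : HasDerivAt (fun x => g a + C * (x - a)) (C * 1) t :=
        (((hasDerivAt_id t).sub_const a).const_mul C).const_add (g a)
      simpa using this.hasDerivWithinAt)
    h (right_mem_Icc.2 hab)
  linarith

lemma abs_sub_le_of_abs_deriv_le {g g' : ℝ → ℝ}
    (hg : ∀ t, 0 ≤ t → HasDerivWithinAt g (g' t) (Ici 0) t) {a b C : ℝ} (ha : 0 ≤ a)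
    (hab : a ≤ b) (h : ∀ t ∈ Ico a b, |g' t| ≤ C) : |g b - g a| ≤ C * (b - a) := by
  have h1 := sub_le_of_deriv_le hg ha hab (fun t ht => (abs_le.1 (h t ht)).2)
  have h2 := sub_le_of_deriv_le (g := fun t => -g t) (g' := fun t => -g' t)
    (fun t ht => (hg t ht).neg) ha hab (C := C) (fun t ht => by have := (abs_le.1 (h t ht)).1; linarith)
  rw [abs_le]
  constructor <;> linarith

/-- A function that decreases at a uniform rate above the level `E` eventually stays below it. -/
lemma eventually_le_of_deriv_le_neg {g g' : ℝ → ℝ}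
    (hg : ∀ t, 0 ≤ t → HasDerivWithinAt g (g' t) (Ici 0) t) {E η : ℝ} (hη : 0 < η)
    (h : ∀ᶠ t in atTop, E ≤ g t → g' t ≤ -η) : ∀ᶠ t in atTop, g t ≤ E := by
  obtain ⟨T, hT⟩ := eventually_atTop.1 (h.and (eventually_ge_atTop 0))
  have hT0 : 0 ≤ T := (hT T le_rfl).2
  obtain ⟨t₁, ht₁, hE⟩ : ∃ t₁, T ≤ t₁ ∧ g t₁ ≤ E := by
    by_contra! hcon
    -- By time `b`, a decrease at rate `η` starting at `T` has taken `g` below `E`.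
    set b := T + (|g T - E| + 1) / η with hb
    have hTb : T ≤ b := by
      have : 0 ≤ (|g T - E| + 1) / η := by positivity
      linarith
    have := sub_le_of_deriv_le hg hT0 hTb (C := -η)
      (fun t ht => (hT t ht.1).1 (hcon t ht.1).le)
    have h2 : -η * (b - T) = -(|g T - E| + 1) := by
      rw [hb]; field_simp; ring
    have h3 := hcon b hTb
    have h4 := le_abs_self (g T - E)
    linarith
  filter_upwards [eventually_ge_atTop t₁] with t ht
  have ht₁0 : 0 ≤ t₁ := hT0.trans ht₁
  -- The level cannot be crossed again: wherever `g = E`, the derivative is negative.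
  refine image_le_of_deriv_right_lt_deriv_boundary (f := g) (f' := g') (a := t₁) (b := t)
    (B := fun _ => E) (B' := fun _ => 0) ?_ ?_ hE (fun x => hasDerivAt_const x E) ?_
    (right_mem_Icc.2 ht)
  · exact fun s hs => ((hg s (ht₁0.trans hs.1)).continuousWithinAt).mono
      (fun r hr => ht₁0.trans hr.1)
  · exact fun s hs => (hg s (ht₁0.trans hs.1)).mono (fun r hr => (ht₁0.trans hs.1).trans hr)
  · intro s hs hsE
    have := (hT s (ht₁.trans hs.1)).1 hsE.ge
    linarith

/-- A signal with bounded derivative whose square is dissipated by a nonnegative storage function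
tends to zero. -/
lemma tendsto_zero_of_dissipation {V V' q q' : ℝ → ℝ}
    (hV : ∀ t, 0 ≤ t → HasDerivWithinAt V (V' t) (Ici 0) t)
    (hq : ∀ t, 0 ≤ t → HasDerivWithinAt q (q' t) (Ici 0) t)
    (hV0 : ∀ t, 0 ≤ t → 0 ≤ V t) {κ : ℝ} (hκ : 0 < κ)
    (hdis : ∀ t, 0 ≤ t → V' t ≤ -(κ * q t ^ 2)) {M : ℝ} (hM : ∀ t, 0 ≤ t → |q' t| ≤ M) :
    Tendsto q atTop (𝓝 0) := by
  have hanti : ∀ a b, 0 ≤ a → a ≤ b → V b ≤ V a := by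
    intro a b ha hab
    have := sub_le_of_deriv_le hV ha hab (C := 0) (fun t ht => by
      have := hdis t (ha.trans ht.1)
      have : 0 ≤ κ * q t ^ 2 := by positivity
      linarith)
    linarith
  have hM0 : 0 ≤ M := (abs_nonneg _).trans (hM 0 le_rfl)
  rw [Metric.tendsto_atTop]
  intro ε hε
  -- Within time `δ` the signal moves by at most `ε / 2`; the `+ 1` covers `M = 0`.
  set δ := ε / (2 * (M + 1)) with hδ
  have hδ0 : 0 < δ := by positivity
  have hMδ : M * δ ≤ ε / 2 := by
    rw [hδ, mul_div_assoc', div_le_div_iff₀ (by positivity) (by positivity)]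
    nlinarith
  by_contra! hcon
  set c := κ * (ε / 2) ^ 2 * δ with hc
  have hc0 : 0 < c := by positivity
  -- Each time `|q|` reaches `ε` it stays above `ε / 2` for time `δ`, which costs `V` at least `c`.
  -- Infinitely many such episodes would make `V` negative.
  have hstep : ∀ n : ℕ, ∃ t, 0 ≤ t ∧ V t ≤ V 0 - n * c := by
    intro n
    induction n with
    | zero => exact ⟨0, le_rfl, by simp⟩
    | succ n ih =>
      obtain ⟨t, ht, hVt⟩ := ih
      obtain ⟨s, hs, hqs⟩ := hcon t
      have hs0 : 0 ≤ s := ht.trans hs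
      refine ⟨s + δ, by linarith, ?_⟩
      have hdec := sub_le_of_deriv_le hV hs0 (by linarith : s ≤ s + δ)
        (C := -(κ * (ε / 2) ^ 2)) (fun r hr => by
          refine (hdis r (hs0.trans hr.1)).trans ?_
          have h1 := abs_sub_le_of_abs_deriv_le hq hs0 hr.1 (C := M)
            (fun x hx => hM x (hs0.trans hx.1))
          have h2 : M * (r - s) ≤ M * δ := by
            apply mul_le_mul_of_nonneg_left _ hM0
            linarith [hr.2]
          rw [Real.dist_eq, sub_zero] at hqs
          have h3 : ε / 2 ≤ |q r| := by
            have := abs_sub_abs_le_abs_sub (q s) (q r)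
            rw [abs_sub_comm] at this
            linarith
          have h4 : (ε / 2) ^ 2 ≤ q r ^ 2 := by
            rw [← sq_abs (q r)]
            gcongr
          have := mul_le_mul_of_nonneg_left h4 hκ.le
          linarith)
      have h1 := hanti t s ht hs
      push_cast
      have : -(κ * (ε / 2) ^ 2) * (s + δ - s) = -c := by rw [hc]; ring
      linarith
  obtain ⟨n, hn⟩ := exists_nat_gt (V 0 / c)
  obtain ⟨t, ht, hVt⟩ := hstep n
  rw [div_lt_iff₀ hc0] at hn
  linarith [hV0 t ht]

/-- A function on the half-line that is continuous and convergent is bounded. -/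
lemma boundedInTime_of_tendsto {g : ℝ → ℝ} {L : ℝ} (hc : ContinuousOn g (Ici 0))
    (hg : Tendsto g atTop (𝓝 L)) : BoundedInTime g := by
  obtain ⟨T, hT⟩ := eventually_atTop.1 (Metric.tendsto_nhds.1 hg 1 one_pos)
  obtain ⟨C, hC⟩ := (isCompact_Icc (a := (0 : ℝ)) (b := T)).exists_bound_of_continuousOn
    (hc.mono Icc_subset_Ici_self)
  refine ⟨max C (|L| + 1), fun t ht => ?_⟩
  rcases le_total t T with h | h
  · exact (hC t ⟨ht, h⟩).trans (le_max_left _ _)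
  · have := hT t h
    rw [Real.dist_eq] at this
    have h2 := abs_sub_abs_le_abs_sub (g t) L
    exact le_trans (by linarith) (le_max_right _ _)

/-! ### Saturated scalar equations and their cascades -/

lemma sat_eq_clamp {Δ : ℝ} (hΔ : 0 < Δ) (s : ℝ) : sat Δ s = max (-Δ) (min s Δ) := by
  unfold sat
  rcases lt_trichotomy s 0 with h | h | h
  · rw [Real.sign_of_neg h, abs_of_neg h, min_eq_left (by linarith : s ≤ Δ)]
    rcases le_total (-s) Δ with h1 | h1
    · rw [min_eq_left h1, max_eq_right (by linarith)]; ring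
    · rw [min_eq_right h1, max_eq_left (by linarith)]; ring
  · subst h
    rw [Real.sign_zero, zero_mul, min_eq_left hΔ.le, max_eq_right (by linarith)]
  · rw [Real.sign_of_pos h, abs_of_pos h, one_mul, max_eq_right]
    exact (by linarith : -Δ ≤ 0).trans (le_min h.le hΔ.le)

lemma abs_sat_le {Δ : ℝ} (hΔ : 0 < Δ) (s : ℝ) : |sat Δ s| ≤ Δ := by
  rw [sat_eq_clamp hΔ, abs_le]
  exact ⟨le_max_left _ _, max_le (by linarith) (min_le_right _ _)⟩

lemma sat_eq_self {Δ s : ℝ} (hΔ : 0 < Δ) (hs : |s| ≤ Δ) : sat Δ s = s := by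
  rw [abs_le] at hs
  rw [sat_eq_clamp hΔ, min_eq_left hs.2, max_eq_right hs.1]

lemma abs_sat_le_abs {Δ : ℝ} (hΔ : 0 < Δ) (s : ℝ) : |sat Δ s| ≤ |s| := by
  rcases le_total |s| Δ with h | h
  · rw [sat_eq_self hΔ h]
  · exact (abs_sat_le hΔ s).trans h

lemma lipschitzWith_sat {Δ : ℝ} (hΔ : 0 < Δ) : LipschitzWith 1 (sat Δ) := by
  have : sat Δ = fun s => max (-Δ) (min s Δ) := funext (sat_eq_clamp hΔ)
  rw [this]
  exact (LipschitzWith.id.min_const Δ).const_max (-Δ)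

/-- Outside `(-ε, ε)` the saturated feedback points inwards with strength at least `ε`; this is the
dissipation estimate for `s ^ 2`. -/
lemma le_mul_sat {Δ ε s : ℝ} (hε : 0 < ε) (hεΔ : ε ≤ Δ) (hs : ε ≤ |s|) :
    |s| * ε ≤ s * sat Δ s := by
  rw [sat_eq_clamp (hε.trans_le hεΔ)]
  rcases le_total 0 s with h | h
  · rw [abs_of_nonneg h] at hs ⊢
    exact mul_le_mul_of_nonneg_left (le_max_of_le_right (le_min hs hεΔ)) h
  · rw [abs_of_nonpos h] at hs ⊢
    have : max (-Δ) (min s Δ) ≤ -ε := max_le (by linarith) ((min_le_left _ _).trans (by linarith))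
    nlinarith

/-- A scalar saturated feedback dominates a disturbance of size less than its gain times `ε`, so
that the state eventually has size at most `ε`. -/
lemma eventually_abs_le_of_saturated {s s' d : ℝ → ℝ} {κ Δ ε δ : ℝ}
    (hs : ∀ t, 0 ≤ t → HasDerivWithinAt s (s' t) (Ici 0) t) (hκ : 0 < κ) (hε : 0 < ε)
    (hεΔ : ε ≤ Δ) (hδ : δ < κ * ε) (hd : ∀ᶠ t in atTop, |d t| ≤ δ)
    (h : ∀ᶠ t in atTop, s' t = -(κ * sat Δ (s t)) + d t) : ∀ᶠ t in atTop, |s t| ≤ ε := by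
  -- Where `|s| ≥ ε`, the derivative of `s ^ 2` is at most `-2|s|(κε - δ) ≤ -2ε(κε - δ)`.
  have key := eventually_le_of_deriv_le_neg (g := fun t => s t ^ 2)
    (g' := fun t => 2 * s t * s' t) (fun t ht => by
      simpa using (hs t ht).fun_pow 2) (E := ε ^ 2) (η := 2 * ε * (κ * ε - δ))
    (by have : 0 < κ * ε - δ := by linarith
        positivity)
    (by
      filter_upwards [hd, h] with t hdt ht hE
      have hεs : ε ≤ |s t| := by
        rw [← abs_of_pos hε]
        exact sq_le_sq.1 hE
      rw [ht]
      have h1 := mul_le_mul_of_nonneg_left (le_mul_sat hε hεΔ hεs) hκ.le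
      have h2 : s t * d t ≤ |s t| * δ :=
        (le_abs_self _).trans (by rw [abs_mul]; gcongr)
      have h3 : ε * (κ * ε - δ) ≤ |s t| * (κ * ε - δ) := by
        apply mul_le_mul_of_nonneg_right hεs
        linarith
      nlinarith)
  filter_upwards [key] with t ht
  exact abs_le_of_sq_le_sq ht hε.le

/-- A vanishing disturbance eventually falls below the threshold of `eventually_abs_le_of_saturated`
for every level `min (ε / 2) Δ`. -/
lemma tendsto_zero_of_saturated {s s' d : ℝ → ℝ} {κ Δ : ℝ}
    (hs : ∀ t, 0 ≤ t → HasDerivWithinAt s (s' t) (Ici 0) t) (hκ : 0 < κ) (hΔ : 0 < Δ)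
    (hd : Tendsto d atTop (𝓝 0))
    (h : ∀ᶠ t in atTop, s' t = -(κ * sat Δ (s t)) + d t) : Tendsto s atTop (𝓝 0) := by
  rw [Metric.tendsto_nhds]
  intro ε hε
  have hε' : 0 < min (ε / 2) Δ := lt_min (by positivity) hΔ
  have := eventually_abs_le_of_saturated hs hκ hε' (min_le_right _ _)
    (δ := κ * min (ε / 2) Δ / 2) (by have := mul_pos hκ hε'; linarith)
    (by
      filter_upwards [Metric.tendsto_nhds.1 hd (κ * min (ε / 2) Δ / 2) (by positivity)] with t ht
      rw [Real.dist_eq, sub_zero] at ht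
      exact ht.le) h
  filter_upwards [this] with t ht
  rw [Real.dist_eq, sub_zero]
  have := min_le_left (ε / 2) Δ
  linarith

/-- This is where `θ < 1 / 2` enters. Inductively, the sum up to exponent `m - n` is below twice its
last term, `2 θ · θ ^ (m - n - 1) < θ ^ (m - n - 1)`. So the feedback gain of a component exceeds
the sum of the gains of all earlier components. -/
lemma sum_range_pow_sub_lt {θ : ℝ} (h0 : 0 < θ) (h1 : θ < 1 / 2) {m n : ℕ} (hn : n ≤ m) :
    ∑ l ∈ Finset.range n, θ ^ (m - l) < θ ^ (m - n) := by
  induction n with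
  | zero => simpa using pow_pos h0 m
  | succ n ih =>
    rw [Finset.sum_range_succ]
    have h2 := ih (by omega)
    have h3 : θ ^ (m - n) = θ * θ ^ (m - (n + 1)) := by
      rw [← pow_succ']; congr 1; omega
    have h4 : 0 < θ ^ (m - (n + 1)) := pow_pos h0 _
    nlinarith

lemma sum_ite_pow_sub_lt {θ : ℝ} (h0 : 0 < θ) (h1 : θ < 1 / 2) {m : ℕ} (k : Fin m) :
    ∑ l : Fin m, (if l < k then θ ^ (m - l.val) else 0) < θ ^ (m - k.val) := by
  have : ∑ l : Fin m, (if l < k then θ ^ (m - l.val) else 0)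
      = ∑ l ∈ Finset.range m, if l < k.val then θ ^ (m - l) else 0 :=
    Fin.sum_univ_eq_sum_range (fun l => if l < k.val then θ ^ (m - l) else 0) m
  rw [this, ← Finset.sum_filter]
  have hf : (Finset.range m).filter (fun l => l < k.val) = Finset.range k.val := by
    ext l
    simp only [Finset.mem_filter, Finset.mem_range]
    omega
  rw [hf]
  exact sum_range_pow_sub_lt h0 h1 k.2.le

lemma sum_split_lt {m : ℕ} (g : Fin m → ℝ) (k : Fin m) :
    ∑ l, g l = ∑ l, (if k < l then g l else 0) + g k + ∑ l, (if l < k then g l else 0) := by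
  have : g k = ∑ l, if l = k then g l else 0 := by simp
  rw [this, ← Finset.sum_add_distrib, ← Finset.sum_add_distrib]
  refine Finset.sum_congr rfl fun l _ => ?_
  rcases lt_trichotomy l k with h | h | h
  · simp [h, h.not_gt, h.ne]
  · simp [h]
  · simp [h, h.not_gt, h.ne']

/-- Convergence of the nested saturation cascade under vanishing disturbances. -/
theorem cascade_tendsto_zero {m : ℕ} {θ Δ : ℝ} (h0 : 0 < θ) (h1 : θ < 1 / 2) (hΔ : 0 < Δ)
    {q d : Fin m → ℝ → ℝ}
    (hq : ∀ k t, 0 ≤ t → HasDerivWithinAt (q k)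
      (∑ l, (if k < l then θ ^ (m - l.val) * q l t else 0)
        - ∑ l, θ ^ (m - l.val) * sat Δ (q l t) + d k t) (Ici 0) t)
    (hd : ∀ k, Tendsto (d k) atTop (𝓝 0)) : ∀ k, Tendsto (q k) atTop (𝓝 0) := by
  -- Once the later components are unsaturated, their linear terms cancel their feedback. What
  -- remains is the component's own feedback, with the earlier saturations as a bounded disturbance.
  have hform : ∀ k, (∀ l, k < l → ∀ᶠ t in atTop, |q l t| ≤ Δ) → ∀ᶠ t in atTop,
      ∑ l, (if k < l then θ ^ (m - l.val) * q l t else 0)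
        - ∑ l, θ ^ (m - l.val) * sat Δ (q l t) + d k t
      = -(θ ^ (m - k.val) * sat Δ (q k t))
        + (d k t - ∑ l, if l < k then θ ^ (m - l.val) * sat Δ (q l t) else 0) := by
    intro k hk
    have hall : ∀ᶠ t in atTop, ∀ l, k < l → |q l t| ≤ Δ := by
      rw [eventually_all]
      intro l
      by_cases hl : k < l
      · filter_upwards [hk l hl] with t ht _ using ht
      · exact Eventually.of_forall fun t h => absurd h hl
    filter_upwards [hall] with t ht
    rw [sum_split_lt (fun l => θ ^ (m - l.val) * sat Δ (q l t)) k]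
    have : ∑ l, (if k < l then θ ^ (m - l.val) * q l t else 0)
        = ∑ l, (if k < l then θ ^ (m - l.val) * sat Δ (q l t) else 0) := by
      refine Finset.sum_congr rfl fun l _ => ?_
      split_ifs with hl
      · rw [sat_eq_self hΔ (ht l hl)]
      · rfl
    rw [this]
    ring
  -- Backward induction, from the last component: the earlier saturations contribute at most `S *
  -- Δ`, strictly less than the available `θ ^ (m - k) * Δ`. Half of that gap is left for `d k`.
  have hunsat : ∀ n : ℕ, ∀ k : Fin m, m - k.val = n → ∀ᶠ t in atTop, |q k t| ≤ Δ := by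
    intro n
    induction n using Nat.strong_induction_on with
    | _ n ih =>
      intro k hk
      have hlater : ∀ l, k < l → ∀ᶠ t in atTop, |q l t| ≤ Δ := by
        intro l hl
        have : k.val < l.val := hl
        exact ih (m - l.val) (by omega) l rfl
      set S := ∑ l : Fin m, (if l < k then θ ^ (m - l.val) else 0) with hS
      have hSlt : S < θ ^ (m - k.val) := sum_ite_pow_sub_lt h0 h1 k
      have hgap : 0 < (θ ^ (m - k.val) - S) * Δ / 2 := by
        have : 0 < θ ^ (m - k.val) - S := by linarith
        positivity
      refine eventually_abs_le_of_saturated (hq k) (pow_pos h0 (m - k.val)) hΔ le_rfl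
        (δ := S * Δ + (θ ^ (m - k.val) - S) * Δ / 2) (by linarith) ?_ (hform k hlater)
      filter_upwards [Metric.tendsto_nhds.1 (hd k) _ hgap] with t ht
      rw [Real.dist_eq, sub_zero] at ht
      have h2 : |∑ l, (if l < k then θ ^ (m - l.val) * sat Δ (q l t) else 0)| ≤ S * Δ := by
        rw [hS, Finset.sum_mul]
        refine (Finset.abs_sum_le_sum_abs _ _).trans (Finset.sum_le_sum fun l _ => ?_)
        split_ifs
        · rw [abs_mul, abs_of_pos (pow_pos h0 _)]
          exact mul_le_mul_of_nonneg_left (abs_sat_le hΔ _) (pow_pos h0 _).le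
        · simp
      have := abs_sub (d k t) (∑ l, if l < k then θ ^ (m - l.val) * sat Δ (q l t) else 0)
      linarith
  -- Forward induction, from the first component: with the earlier components tending to zero, the
  -- whole disturbance vanishes.
  have hzero : ∀ n : ℕ, ∀ k : Fin m, k.val = n → Tendsto (q k) atTop (𝓝 0) := by
    intro n
    induction n using Nat.strong_induction_on with
    | _ n ih =>
      intro k hk
      refine tendsto_zero_of_saturated (hq k) (pow_pos h0 (m - k.val)) hΔ ?_
        (hform k fun l _ => hunsat _ l rfl)
      have : Tendsto (fun t => ∑ l, if l < k then θ ^ (m - l.val) * sat Δ (q l t) else 0)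
          atTop (𝓝 (∑ _l : Fin m, 0)) := by
        refine tendsto_finsetSum _ fun l _ => ?_
        split_ifs with hl
        · have hl' : l.val < k.val := hl
          have h2 := ih l.val (by omega) l rfl
          have h3 : Tendsto (fun t => sat Δ (q l t)) atTop (𝓝 0) :=
            squeeze_zero_norm (fun t => abs_sat_le_abs hΔ (q l t)) (by simpa using h2.abs)
          simpa using h3.const_mul (θ ^ (m - l.val))
        · exact tendsto_const_nhds
      simpa using (hd k).sub this
  exact fun k => hzero _ k rfl

/-! ### Global solutions of globally Lipschitz equations -/

section GlobalSolution

variable {E : Type*} [NormedAddCommGroup E] [NormedSpace ℝ E]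

lemma eqOn_of_solutions {v : E → E} {K : NNReal} (hv : LipschitzWith K v) {a : ℝ}
    {γ β : ℝ → E} (h0 : γ 0 = β 0)
    (hγ : ∀ t ∈ Icc 0 a, HasDerivWithinAt γ (v (γ t)) (Icc 0 a) t)
    (hβ : ∀ t ∈ Icc 0 a, HasDerivWithinAt β (v (β t)) (Icc 0 a) t) : EqOn γ β (Icc 0 a) := by
  have conv : ∀ δ : ℝ → E, (∀ t ∈ Icc 0 a, HasDerivWithinAt δ (v (δ t)) (Icc 0 a) t) →
      ∀ t ∈ Ico 0 a, HasDerivWithinAt δ (v (δ t)) (Ici t) t := by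
    intro δ hδ t ht
    have h1 := (hδ t (Ico_subset_Icc_self ht)).mono
      (Icc_subset_Icc ht.1 le_rfl : Icc t a ⊆ Icc 0 a)
    exact h1.mono_of_mem_nhdsWithin (Icc_mem_nhdsGE ht.2)
  exact ODE_solution_unique_of_mem_Icc_right (v := fun _ => v) (s := fun _ => univ) (K := K)
    (fun t _ => hv.lipschitzOnWith)
    (fun t ht => (hγ t ht).continuousWithinAt) (conv γ hγ) (fun _ _ => mem_univ _)
    (fun t ht => (hβ t ht).continuousWithinAt) (conv β hβ) (fun _ _ => mem_univ _) h0

lemma HasDerivWithinAt.glue {γ β : ℝ → E} {v : E → E} {a h : ℝ} (ha : 0 ≤ a) (hh : 0 < h)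
    (h0 : β 0 = γ a)
    (hγ : ∀ t ∈ Icc 0 a, HasDerivWithinAt γ (v (γ t)) (Icc 0 a) t)
    (hβ : ∀ t ∈ Icc 0 h, HasDerivWithinAt β (v (β t)) (Icc 0 h) t) :
    ∀ t ∈ Icc 0 (a + h), HasDerivWithinAt (fun t => if t ≤ a then γ t else β (t - a))
      (v (if t ≤ a then γ t else β (t - a))) (Icc 0 (a + h)) t := by
  set δ : ℝ → E := fun t => if t ≤ a then γ t else β (t - a) with hδ
  have hδγ : ∀ t ≤ a, δ t = γ t := fun t ht => by simp [hδ, ht]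
  have hδβ : ∀ t, a ≤ t → δ t = β (t - a) := fun t ht => by
    rcases ht.eq_or_lt with rfl | ht
    · simp [hδ, h0]
    · simp [hδ, ht.not_ge]
  have hunion : Icc 0 (a + h) = Icc 0 a ∪ Icc a (a + h) :=
    (Icc_union_Icc_eq_Icc ha (by linarith)).symm
  intro t ht
  change HasDerivWithinAt δ (v (δ t)) _ t
  rw [hunion]
  refine HasDerivWithinAt.union ?_ ?_
  · by_cases hta : t ≤ a
    · rw [hδγ t hta]
      exact (hγ t ⟨ht.1, hta⟩).congr (fun s hs => hδγ s hs.2) (hδγ t hta)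
    -- Away from the closure of the piece, any derivative within it is correct.
    · refine HasFDerivWithinAt.of_notMem_closure ?_
      rw [isClosed_Icc.closure_eq]
      exact fun h => hta h.2
  · by_cases hta : a ≤ t
    · rw [hδβ t hta]
      have h1 := hβ (t - a) ⟨by linarith, by linarith [ht.2]⟩
      have h2 : HasDerivWithinAt (fun s => s - a) 1 (Icc a (a + h)) t :=
        (hasDerivWithinAt_id t _).sub_const a
      have hmaps : MapsTo (fun s => s - a) (Icc a (a + h)) (Icc 0 h) :=
        fun s hs => ⟨by linarith [hs.1], by linarith [hs.2]⟩
      have h3 := HasDerivWithinAt.scomp t h1 h2 hmaps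
      rw [one_smul] at h3
      exact h3.congr (fun s hs => hδβ s hs.1) (hδβ t hta)
    · refine HasFDerivWithinAt.of_notMem_closure ?_
      rw [isClosed_Icc.closure_eq]
      exact fun h => hta h.1

variable [CompleteSpace E]

/-- The step `1 / (2 * K)` does not depend on `x₀`, so local solutions can be glued indefinitely. On
the ball of radius `‖v x₀‖ / K` the field is at most `2 * ‖v x₀‖`, and that speed over that time
covers exactly the radius. -/
lemma exists_local_solution {v : E → E} {K : NNReal} (hK : 0 < K) (hv : LipschitzWith K v)
    (x₀ : E) : ∃ γ : ℝ → E, γ 0 = x₀ ∧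
      ∀ t ∈ Icc (0 : ℝ) (1 / (2 * K)),
        HasDerivWithinAt γ (v (γ t)) (Icc (0 : ℝ) (1 / (2 * K))) t := by
  have hK' : (0 : ℝ) < K := hK
  have hh : (0 : ℝ) ≤ 1 / (2 * K) := by positivity
  have hPL : IsPicardLindelof (fun _ => v) (tmin := 0) (tmax := 1 / (2 * (K : ℝ)))
      ⟨0, le_rfl, hh⟩ x₀ (‖v x₀‖₊ / K) 0 (2 * ‖v x₀‖₊) K := by
    refine IsPicardLindelof.of_time_independent ?_ hv.lipschitzOnWith ?_
    · intro x hx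
      rw [Metric.mem_closedBall] at hx
      have h1 := hv.dist_le_mul x x₀
      rw [dist_eq_norm] at h1
      have h2 : (K : ℝ) * dist x x₀ ≤ ‖v x₀‖ := by
        have := mul_le_mul_of_nonneg_left hx hK'.le
        refine this.trans_eq ?_
        push_cast
        field_simp
      have h3 := norm_sub_norm_le (v x) (v x₀)
      push_cast
      linarith
    · simp only [sub_zero, sub_self]
      rw [max_eq_left hh]
      push_cast
      simp only [sub_zero]
      apply le_of_eq
      field_simp
  exact hPL.exists_eq_forall_mem_Icc_hasDerivWithinAt₀

/-- An autonomous equation with a globally Lipschitz right-hand side has a solution on `[0, ∞)`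
for every initial value. -/
theorem exists_global_solution {v : E → E} {K : NNReal} (hv : LipschitzWith K v) (x₀ : E) :
    ∃ γ : ℝ → E, γ 0 = x₀ ∧ ∀ t, 0 ≤ t → HasDerivWithinAt γ (v (γ t)) (Ici 0) t := by
  obtain ⟨K, hK, hv⟩ : ∃ K : NNReal, 0 < K ∧ LipschitzWith K v :=
    ⟨K + 1, by positivity, hv.weaken (by simp)⟩
  set h : ℝ := 1 / (2 * K) with hh
  have hh0 : 0 < h := by
    have : (0 : ℝ) < K := hK
    positivity
  have hex : ∀ n : ℕ, ∃ γ : ℝ → E, γ 0 = x₀ ∧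
      ∀ t ∈ Icc 0 (n * h), HasDerivWithinAt γ (v (γ t)) (Icc 0 (n * h)) t := by
    intro n
    induction n with
    | zero =>
      refine ⟨fun _ => x₀, rfl, fun t _ => ?_⟩
      simp only [Nat.cast_zero, zero_mul, Icc_self]
      exact HasFDerivWithinAt.of_subsingleton subsingleton_singleton
    | succ n ih =>
      obtain ⟨γ, hγ0, hγ⟩ := ih
      obtain ⟨β, hβ0, hβ⟩ := exists_local_solution hK hv (γ (n * h))
      have ha : 0 ≤ n * h := by positivity
      refine ⟨fun t => if t ≤ n * h then γ t else β (t - n * h), by simp [ha, hγ0], ?_⟩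
      have := HasDerivWithinAt.glue ha hh0 hβ0 hγ hβ
      have hcast : ((n + 1 : ℕ) : ℝ) * h = n * h + h := by push_cast; ring
      rw [hcast]
      exact this
  choose γ hγ0 hγ using hex
  have heq : ∀ n k : ℕ, n ≤ k → EqOn (γ n) (γ k) (Icc 0 (n * h)) := by
    intro n k hnk
    have hle : (n : ℝ) * h ≤ k * h := by gcongr
    refine eqOn_of_solutions hv ((hγ0 n).trans (hγ0 k).symm) (hγ n) fun t ht => ?_
    exact (hγ k t ⟨ht.1, ht.2.trans hle⟩).mono (Icc_subset_Icc_right hle)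
  -- The global solution reads its value at `t` from the solution on `[0, ν t * h]`; by uniqueness
  -- any longer interval gives the same value.
  set ν : ℝ → ℕ := fun t => ⌈t / h⌉₊ with hν
  have hle : ∀ t, t ≤ ν t * h := fun t => by
    rw [← div_le_iff₀ hh0]
    exact Nat.le_ceil _
  have hany : ∀ t, 0 ≤ t → ∀ n : ℕ, t ≤ n * h → γ (ν t) t = γ n t := by
    intro t ht n hn
    rcases le_total (ν t) n with hc | hc
    · exact heq _ _ hc ⟨ht, hle t⟩
    · exact (heq _ _ hc ⟨ht, hn⟩).symm
  refine ⟨fun t => γ (ν t) t, by simp [hγ0], fun t ht => ?_⟩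
  -- One extra interval puts `t` strictly before the right end, so that the derivative within `Ici
  -- 0` can be taken.
  set n := ν t + 1 with hn
  have htn : t < n * h := by
    have := hle t
    rw [hn]; push_cast; linarith
  have h1 : HasDerivWithinAt (γ n) (v (γ n t)) (Ici 0) t := by
    refine (hγ n t ⟨ht, htn.le⟩).mono_of_mem_nhdsWithin ?_
    have : Iio ((n : ℝ) * h) ∈ 𝓝 t := Iio_mem_nhds htn
    filter_upwards [self_mem_nhdsWithin, mem_nhdsWithin_of_mem_nhds this] with s hs hs'
    exact ⟨hs, le_of_lt hs'⟩
  simp only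
  rw [hany t ht n htn.le]
  refine h1.congr_of_eventuallyEq ?_ (hany t ht n htn.le)
  have : Iio ((n : ℝ) * h) ∈ 𝓝 t := Iio_mem_nhds htn
  filter_upwards [self_mem_nhdsWithin, mem_nhdsWithin_of_mem_nhds this] with s hs hs'
  exact hany s hs n (le_of_lt hs')

end GlobalSolution

/-! ### Controllability matrices of strictly upper triangular pairs -/

section Controllability

variable {m : ℕ} {A : Matrix (Fin m) (Fin m) ℝ} {B : Fin m → ℝ}

lemma pow_succ_mulVec_apply (A : Matrix (Fin m) (Fin m) ℝ) (B : Fin m → ℝ) (k : ℕ) (j : Fin m) :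
    (A ^ (k + 1)).mulVec B j = ∑ l, A j l * (A ^ k).mulVec B l := by
  rw [pow_succ', ← Matrix.mulVec_mulVec]
  rfl

/-- Each application of a strictly upper triangular matrix kills one more entry from the bottom, so
the controllability matrix vanishes below its antidiagonal. -/
lemma pow_mulVec_eq_zero (hA : ∀ j k, ¬ j < k → A j k = 0) (k : ℕ) (j : Fin m)
    (h : m ≤ j.val + k) : (A ^ k).mulVec B j = 0 := by
  induction k generalizing j with
  | zero => exact absurd h (by omega)
  | succ k ih =>
    rw [pow_succ_mulVec_apply]
    refine Finset.sum_eq_zero fun l _ => ?_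
    by_cases hl : j < l
    · have : j.val < l.val := hl
      rw [ih l (by omega), mul_zero]
    · rw [hA j l hl, zero_mul]

lemma pow_succ_mulVec_antidiagonal (hA : ∀ j k, ¬ j < k → A j k = 0) (k : ℕ) (j l : Fin m)
    (hl : l.val = j.val + 1) (h : l.val + k + 1 = m) :
    (A ^ (k + 1)).mulVec B j = A j l * (A ^ k).mulVec B l := by
  rw [pow_succ_mulVec_apply]
  refine Finset.sum_eq_single l (fun i _ hi => ?_) (by simp)
  by_cases hij : j < i
  · have h1 : j.val < i.val := hij
    have h2 : i.val ≠ l.val := fun h => hi (Fin.ext h)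
    rw [pow_mulVec_eq_zero hA k i (by omega), mul_zero]
  · rw [hA j i hij, zero_mul]

lemma pow_mulVec_antidiagonal_ne_zero (hA : ∀ j k, ¬ j < k → A j k = 0)
    (hA' : ∀ j k : Fin m, k.val = j.val + 1 → A j k ≠ 0)
    (hB : ∀ j : Fin m, j.val + 1 = m → B j ≠ 0) (k : ℕ) (j : Fin m) (h : j.val + k + 1 = m) :
    (A ^ k).mulVec B j ≠ 0 := by
  induction k generalizing j with
  | zero => simpa using hB j (by omega)
  | succ k ih =>
    rw [pow_succ_mulVec_antidiagonal hA k j ⟨j.val + 1, by omega⟩ rfl (by simp only; omega)]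
    exact mul_ne_zero (hA' _ _ rfl) (ih _ (by simp only; omega))

/-- Reversing the columns makes the controllability matrix upper triangular, and its diagonal
entries are then products of superdiagonal entries of `A` with the last entry of `B`. -/
lemma isUnit_det_controllability (hA : ∀ j k, ¬ j < k → A j k = 0)
    (hA' : ∀ j k : Fin m, k.val = j.val + 1 → A j k ≠ 0)
    (hB : ∀ j : Fin m, j.val + 1 = m → B j ≠ 0) : IsUnit (controllability A B).det := by
  have h1 : ((controllability A B).submatrix id (Fin.revPerm : Equiv.Perm (Fin m))).det ≠ 0 := by
    rw [Matrix.det_of_isUpperTriangular]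
    · refine Finset.prod_ne_zero_iff.2 fun j _ => ?_
      simp only [Matrix.submatrix_apply, controllability, Matrix.of_apply, id, Fin.revPerm_apply]
      exact pow_mulVec_antidiagonal_ne_zero hA hA' hB _ _ (by rw [Fin.val_rev]; omega)
    · intro j k hjk
      have hjk' : k.val < j.val := hjk
      simp only [Matrix.submatrix_apply, controllability, Matrix.of_apply, id, Fin.revPerm_apply]
      exact pow_mulVec_eq_zero hA _ _ (by rw [Fin.val_rev]; omega)
  rw [Matrix.det_permute'] at h1
  exact isUnit_iff_ne_zero.2 (right_ne_zero_of_mul h1)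

/-- The nilpotent down-shift, which is the companion form common to all nilpotent pairs. -/
def downShift (m : ℕ) : Matrix (Fin m) (Fin m) ℝ :=
  Matrix.of fun j k => if j.val = k.val + 1 then 1 else 0

/-- `A` moves each column `A ^ k B` to the next and sends the last one to `A ^ m B = 0`. The right
factor is the same for all nilpotent pairs, which is what links the two of them. -/
lemma mul_controllability (hA : ∀ j k, ¬ j < k → A j k = 0) :
    A * controllability A B = controllability A B * downShift m := by
  ext j k
  have hl : (A * controllability A B) j k = (A ^ (k.val + 1)).mulVec B j := by
    rw [pow_succ_mulVec_apply]
    rfl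
  rw [hl, Matrix.mul_apply]
  by_cases hk : k.val + 1 < m
  · rw [Finset.sum_eq_single ⟨k.val + 1, hk⟩]
    · simp [downShift, controllability]
    · intro l _ hl
      have : l.val ≠ k.val + 1 := fun h => hl (Fin.ext h)
      simp [downShift, this]
    · simp
  · rw [pow_mulVec_eq_zero hA _ _ (by omega)]
    refine (Finset.sum_eq_zero fun l _ => ?_).symm
    have : l.val ≠ k.val + 1 := by omega
    simp [downShift, this]

lemma controllability_mulVec_single (k : Fin m) :
    (controllability A B).mulVec (Pi.single k 1) = (A ^ k.val).mulVec B := by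
  ext j
  simp [controllability]

end Controllability

/-! ### The transformation of the integrator chains -/

section Transformation

variable {m : ℕ} {θ : ℝ}

lemma chainA_upper (j k : Fin m) (h : ¬ j < k) : chainA m j k = 0 := by
  have : ¬ j.val < k.val := h
  have : k.val ≠ j.val + 1 := by omega
  simp [chainA, this]

lemma barA_upper (j k : Fin m) (h : ¬ j < k) : barA m θ j k = 0 := by simp [barA, h]

lemma isUnit_det_controllability_chain : IsUnit (controllability (chainA m) (chainB m)).det :=
  isUnit_det_controllability chainA_upper (fun j k h => by simp [chainA, h])
    (fun j h => by simp [chainB, h])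

lemma isUnit_det_controllability_bar (hθ : 0 < θ) :
    IsUnit (controllability (barA m θ) (barB m)).det :=
  isUnit_det_controllability barA_upper
    (fun j k h => by
      have : j < k := by rw [Fin.lt_def]; omega
      simp [barA, this, hθ.ne'])
    (fun j _ => by simp [barB])

lemma isUnit_det_transT (hθ : 0 < θ) : IsUnit (transT m θ).det := by
  rw [transT, Matrix.det_mul]
  exact isUnit_det_controllability_chain.mul
    (by rw [Matrix.det_nonsing_inv]; exact (isUnit_det_controllability_bar hθ).ringInverse)

lemma transT_mul_controllability (hθ : 0 < θ) :
    transT m θ * controllability (barA m θ) (barB m) = controllability (chainA m) (chainB m) := by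
  rw [transT, Matrix.mul_assoc, Matrix.nonsing_inv_mul _ (isUnit_det_controllability_bar hθ),
    mul_one]

/-- Both matrices are conjugate to `downShift m` through their controllability matrices, and `T` is
the quotient of these. -/
lemma chainA_mul_transT (hθ : 0 < θ) : chainA m * transT m θ = transT m θ * barA m θ := by
  have h1 : (chainA m * transT m θ) * controllability (barA m θ) (barB m)
      = (transT m θ * barA m θ) * controllability (barA m θ) (barB m) := by
    rw [Matrix.mul_assoc, transT_mul_controllability hθ, Matrix.mul_assoc,
      mul_controllability barA_upper, ← Matrix.mul_assoc, transT_mul_controllability hθ,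
      mul_controllability chainA_upper]
  have hu := isUnit_det_controllability_bar (m := m) hθ
  calc chainA m * transT m θ
      = (chainA m * transT m θ) * controllability (barA m θ) (barB m)
          * (controllability (barA m θ) (barB m))⁻¹ := by
        rw [Matrix.mul_assoc _ _ (_⁻¹), Matrix.mul_nonsing_inv _ hu, mul_one]
    _ = transT m θ * barA m θ := by
        rw [h1, Matrix.mul_assoc _ _ (_⁻¹), Matrix.mul_nonsing_inv _ hu, mul_one]

lemma transT_mulVec_pow (hθ : 0 < θ) (k : Fin m) :
    (transT m θ).mulVec ((barA m θ ^ k.val).mulVec (barB m))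
      = (chainA m ^ k.val).mulVec (chainB m) := by
  rw [← controllability_mulVec_single, Matrix.mulVec_mulVec, transT_mul_controllability hθ,
    controllability_mulVec_single]

lemma transT_mulVec_barB (hθ : 0 < θ) (hm : 0 < m) :
    (transT m θ).mulVec (barB m) = chainB m := by
  simpa using transT_mulVec_pow hθ (⟨0, hm⟩ : Fin m)

/-- Climbing the antidiagonal by one row multiplies by a superdiagonal entry of `Ā`, and from the
bottom these are `θ, θ², …`. The top entry, `k = m - 1`, is the constant `P` in the controller. -/
lemma barA_pow_mulVec_antidiagonal (k : ℕ) (j : Fin m) (h : j.val + k + 1 = m) :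
    (barA m θ ^ k).mulVec (barB m) j = ∏ i ∈ Finset.Icc 1 k, θ ^ i := by
  induction k generalizing j with
  | zero => simp [barB]
  | succ k ih =>
    rw [pow_succ_mulVec_antidiagonal barA_upper k j ⟨j.val + 1, by omega⟩ rfl
      (by simp only; omega), ih _ (by simp only; omega), Finset.prod_Icc_succ_top (by omega), mul_comm]
    congr 1
    have : j < ⟨j.val + 1, by omega⟩ := by rw [Fin.lt_def]; simp
    simp only [barA, Matrix.of_apply, this, if_true]
    congr 1
    omega

lemma chainA_pow_mulVec_antidiagonal (k : ℕ) (j : Fin m) (h : j.val + k + 1 = m) :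
    (chainA m ^ k).mulVec (chainB m) j = 1 := by
  induction k generalizing j with
  | zero => simp only [pow_zero, Matrix.one_mulVec, chainB]; rw [if_pos (by omega)]
  | succ k ih =>
    rw [pow_succ_mulVec_antidiagonal chainA_upper k j ⟨j.val + 1, by omega⟩ rfl
      (by simp only; omega), ih _ (by simp only; omega)]
    simp [chainA]

lemma pow_pred_mulVec_eq {A : Matrix (Fin m) (Fin m) ℝ} {B : Fin m → ℝ}
    (hA : ∀ j k, ¬ j < k → A j k = 0) (hm : 0 < m) {p : ℝ}
    (hp : (A ^ (m - 1)).mulVec B ⟨0, hm⟩ = p) :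
    (A ^ (m - 1)).mulVec B = p • Pi.single ⟨0, hm⟩ (1 : ℝ) := by
  ext j
  rcases eq_or_ne j ⟨0, hm⟩ with rfl | hj
  · simp [hp]
  · have : j.val ≠ 0 := fun h => hj (Fin.ext h)
    rw [pow_mulVec_eq_zero hA _ _ (by omega)]
    simp [hj]

/-- The transformation maps `P e₁` to `e₁`, where `P = ∏ₖ θᵏ`. -/
lemma transT_mulVec_single (hθ : 0 < θ) (hm : 0 < m) :
    (transT m θ).mulVec ((∏ i ∈ Finset.Icc 1 (m - 1), θ ^ i) • Pi.single ⟨0, hm⟩ (1 : ℝ))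
      = Pi.single ⟨0, hm⟩ 1 := by
  -- The last columns of the two controllability matrices are `P e₁` and `e₁`.
  have h := transT_mulVec_pow hθ (⟨m - 1, by omega⟩ : Fin m)
  simp only at h
  rwa [pow_pred_mulVec_eq barA_upper hm (barA_pow_mulVec_antidiagonal (m - 1) ⟨0, hm⟩
      (by simp only; omega)),
    pow_pred_mulVec_eq chainA_upper hm (chainA_pow_mulVec_antidiagonal (m - 1) ⟨0, hm⟩
      (by simp only; omega)), one_smul] at h

lemma transT_inv_mulVec_dynamics (hθ : 0 < θ) (hm : 0 < m) (x : Fin m → ℝ) (u : ℝ) :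
    (transT m θ)⁻¹.mulVec ((chainA m).mulVec x + u • chainB m)
      = (barA m θ).mulVec ((transT m θ)⁻¹.mulVec x) + u • barB m := by
  have hu := isUnit_det_transT (m := m) hθ
  have hB : (transT m θ)⁻¹.mulVec (chainB m) = barB m := by
    rw [← transT_mulVec_barB hθ hm, Matrix.mulVec_mulVec, Matrix.nonsing_inv_mul _ hu,
      Matrix.one_mulVec]
  have hA : (transT m θ)⁻¹ * chainA m = barA m θ * (transT m θ)⁻¹ := by
    calc (transT m θ)⁻¹ * chainA m
        = (transT m θ)⁻¹ * (chainA m * transT m θ) * (transT m θ)⁻¹ := by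
          rw [Matrix.mul_assoc, Matrix.mul_assoc, Matrix.mul_nonsing_inv _ hu, mul_one]
      _ = barA m θ * (transT m θ)⁻¹ := by
          rw [chainA_mul_transT hθ, ← Matrix.mul_assoc, Matrix.nonsing_inv_mul _ hu, one_mul]
  rw [Matrix.mulVec_add, Matrix.mulVec_smul, hB, Matrix.mulVec_mulVec, hA, Matrix.mulVec_mulVec]

/-- The argument of the saturation acting on component `k`: the component itself, shifted by
`P w` in the first one. -/
def satArg {m : ℕ} (θ : ℝ) (xb : Fin m → ℝ) (w : ℝ) (k : Fin m) : ℝ :=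
  xb k + if k.val = 0 then (∏ i ∈ Finset.Icc 1 (m - 1), θ ^ i) * w else 0

/-- Collects all feedback terms in one sum with the same weights `θ ^ (m - k)` as the columns of
`Ā`, so that they can cancel. -/
lemma satControl_eq {m : ℕ} (hm : 1 < m) (θ Δ : ℝ) (xb : Fin m → ℝ) (w : ℝ) :
    satControl hm θ Δ xb w
      = -∑ k : Fin m, θ ^ (m - k.val) * sat Δ (satArg θ xb w k) := by
  obtain ⟨n, rfl⟩ : ∃ n, m = n + 1 := ⟨m - 1, by omega⟩
  rw [Fin.sum_univ_succ]
  have h0 : satArg θ xb w (0 : Fin (n + 1))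
      = xb ⟨0, by omega⟩ + (∏ i ∈ Finset.Icc 1 (n + 1 - 1), θ ^ i) * w := by
    simp [satArg]
  have h1 : ∑ k : Fin (n + 1 - 1), θ ^ (k.val + 1) * sat Δ (xb ⟨n + 1 - 1 - k.val, by omega⟩)
      = ∑ k : Fin n, θ ^ (n + 1 - k.succ.val) * sat Δ (satArg θ xb w k.succ) := by
    -- The controller lists its terms from the last component down.
    refine Fintype.sum_equiv Fin.revPerm _ _ fun k => ?_
    have hk : k.val < n := k.2
    have e1 : n + 1 - (Fin.succ (Fin.revPerm k : Fin n)).val = k.val + 1 := by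
      simp only [Fin.revPerm_apply, Fin.val_succ, Fin.val_rev]
      omega
    have e2 : (⟨n + 1 - 1 - k.val, by omega⟩ : Fin (n + 1)) = Fin.succ (Fin.revPerm k : Fin n) := by
      ext
      simp only [Fin.revPerm_apply, Fin.val_succ, Fin.val_rev]
      omega
    rw [e1, e2]
    simp [satArg]
  rw [satControl, h1, h0]
  simp only [Fin.val_zero, Nat.sub_zero]
  ring

/-- The first column of `Ā` is zero, so shifting the first component by `P w` does not change the
linear part. -/
lemma barA_mulVec_apply {m : ℕ} (θ : ℝ) (xb : Fin m → ℝ) (w : ℝ) (k : Fin m) :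
    (barA m θ).mulVec xb k
      = ∑ l, if k < l then θ ^ (m - l.val) * satArg θ xb w l else 0 := by
  simp only [Matrix.mulVec, dotProduct]
  refine Finset.sum_congr rfl fun l _ => ?_
  by_cases h : k < l
  · have h' : k.val < l.val := h
    have : l.val ≠ 0 := by omega
    simp [barA, h, satArg, this]
  · simp [barA, h]

end Transformation

/-! ### Existence and uniqueness of the Nash equilibrium -/

section Game

variable {N : ℕ} {f : Fin N → EuclideanSpace ℝ (Fin N) → ℝ}

lemma SmoothLipschitz.exists_uniform (hf : SmoothLipschitz f) :
    ∃ l : ℝ, 0 < l ∧ ∀ i (y z : EuclideanSpace ℝ (Fin N)),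
      |ownGrad f i y - ownGrad f i z| ≤ l * ‖y - z‖ := by
  choose hd l hl hlip using hf
  refine ⟨1 + ∑ i, l i, ?_, fun i y z => (hlip i y z).trans ?_⟩
  · have := Finset.sum_nonneg fun i (_ : i ∈ Finset.univ) => (hl i).le
    linarith
  · have := Finset.single_le_sum (fun i _ => (hl i).le) (Finset.mem_univ i)
    gcongr
    linarith

/-- A strongly monotone Lipschitz pseudo-gradient has a zero. -/
lemma exists_ownGrad_eq_zero (hf : SmoothLipschitz f) (hmono : StronglyMonotone f) :
    ∃ y, ∀ i, ownGrad f i y = 0 := by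
  obtain ⟨l, hl, hlip⟩ := hf.exists_uniform
  obtain ⟨ω, hω, hmon⟩ := hmono
  set L : ℝ := N * l ^ 2 + ω ^ 2 with hL
  have hL0 : 0 < L := by positivity
  -- This step minimises `1 - 2εω + ε²L`, with minimum `k`. Including `ω ^ 2` in `L` ensures `L > 0`
  -- and `0 ≤ k`.
  set ε : ℝ := ω / L with hε
  have hε0 : 0 < ε := by positivity
  set Φ : EuclideanSpace ℝ (Fin N) → EuclideanSpace ℝ (Fin N) :=
    fun y => WithLp.toLp 2 fun i => y i - ε * ownGrad f i y with hΦ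
  set k : ℝ := 1 - ω ^ 2 / L with hk
  have hk1 : k < 1 := by
    have : 0 < ω ^ 2 / L := by positivity
    linarith
  have hk0 : 0 ≤ k := by
    have : ω ^ 2 / L ≤ 1 := by
      rw [div_le_one hL0, hL]
      have : 0 ≤ (N : ℝ) * l ^ 2 := by positivity
      linarith
    linarith
  have hsq : ∀ y z, ‖Φ y - Φ z‖ ^ 2 ≤ k * ‖y - z‖ ^ 2 := by
    intro y z
    have h1 : ‖Φ y - Φ z‖ ^ 2 = ‖y - z‖ ^ 2
        - 2 * ε * ∑ i, (y i - z i) * (ownGrad f i y - ownGrad f i z)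
        + ε ^ 2 * ∑ i, (ownGrad f i y - ownGrad f i z) ^ 2 := by
      rw [EuclideanSpace.real_norm_sq_eq, EuclideanSpace.real_norm_sq_eq, Finset.mul_sum,
        Finset.mul_sum, ← Finset.sum_sub_distrib, ← Finset.sum_add_distrib]
      refine Finset.sum_congr rfl fun i _ => ?_
      simp only [hΦ, PiLp.sub_apply]
      ring
    have h2 : ∑ i, (ownGrad f i y - ownGrad f i z) ^ 2 ≤ N * l ^ 2 * ‖y - z‖ ^ 2 := by
      have : ∀ i ∈ Finset.univ, (ownGrad f i y - ownGrad f i z) ^ 2 ≤ l ^ 2 * ‖y - z‖ ^ 2 := by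
        intro i _
        rw [← sq_abs, ← mul_pow]
        gcongr
        exact hlip i y z
      have := Finset.sum_le_card_nsmul _ _ _ this
      simpa [mul_assoc] using this
    have h3 := hmon y z
    have h4 : k = 1 - 2 * ε * ω + ε ^ 2 * L := by
      rw [hk, hε]
      field_simp
      ring
    have h5 : ε ^ 2 * (N * l ^ 2) ≤ ε ^ 2 * L := by
      gcongr
      rw [hL]
      have := sq_nonneg ω
      linarith
    have h6 := mul_le_mul_of_nonneg_left h3 hε0.le
    have h7 := mul_le_mul_of_nonneg_left h2 (sq_nonneg ε)
    have h8 := mul_le_mul_of_nonneg_right h5 (sq_nonneg ‖y - z‖)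
    rw [h1, h4]
    linarith
  have hcontr : ContractingWith (Real.toNNReal (√k)) Φ := by
    refine ⟨?_, LipschitzWith.of_dist_le_mul fun y z => ?_⟩
    · rw [Real.toNNReal_lt_one]
      rw [Real.sqrt_lt' one_pos]
      linarith
    · rw [dist_eq_norm, dist_eq_norm, Real.coe_toNNReal _ (Real.sqrt_nonneg _)]
      refine le_of_sq_le_sq ?_ (by positivity)
      rw [mul_pow, Real.sq_sqrt hk0]
      exact hsq y z
  refine ⟨hcontr.fixedPoint, fun i => ?_⟩
  have h := congrArg (fun y : EuclideanSpace ℝ (Fin N) => y i) hcontr.fixedPoint_isFixedPt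
  simp only [hΦ] at h
  have : ε * ownGrad f i hcontr.fixedPoint = 0 := by
    simp only [hΦ]
    linarith
  exact (mul_eq_zero.1 this).resolve_left hε0.ne'

lemma deviate_apply (y : EuclideanSpace ℝ (Fin N)) (i j : Fin N) (s : ℝ) :
    deviate y i s j = if j = i then s else y j := by
  simp [deviate, Function.update_apply]

lemma deviate_self (y : EuclideanSpace ℝ (Fin N)) (i : Fin N) : deviate y i (y i) = y := by
  ext j
  rw [deviate_apply]
  split_ifs with h
  · rw [h]
  · rfl

lemma hasDerivAt_deviate (hf : SmoothLipschitz f) (y : EuclideanSpace ℝ (Fin N)) (i : Fin N)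
    (s : ℝ) : HasDerivAt (fun s => f i (deviate y i s)) (ownGrad f i (deviate y i s)) s := by
  have h1 : HasDerivAt (fun s => y + (s - y i) • EuclideanSpace.single i (1 : ℝ))
      ((1 : ℝ) • EuclideanSpace.single i (1 : ℝ)) s :=
    (((hasDerivAt_id s).sub_const (y i)).smul_const _).const_add y
  have h2 : (fun s => deviate y i s) = fun s => y + (s - y i) • EuclideanSpace.single i (1 : ℝ) := by
    funext s
    ext j
    rw [deviate_apply]
    by_cases h : j = i
    · subst h; simp
    · simp [h]
  rw [← h2, one_smul] at h1
  have h3 : HasFDerivAt (f i) (fderiv ℝ (f i) (deviate y i s)) (deviate y i s) :=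
    ((hf i).1.differentiable one_ne_zero _).hasFDerivAt
  exact h3.comp_hasDerivAt s h1

/-- Sufficiency of the first-order condition: monotonicity along the `i`-th coordinate line makes
`fᵢ` nonincreasing before `y i` and nondecreasing after it. -/
lemma isNashEquilibrium_iff (hf : SmoothLipschitz f) (hmono : StronglyMonotone f)
    (y : EuclideanSpace ℝ (Fin N)) : IsNashEquilibrium f y ↔ ∀ i, ownGrad f i y = 0 := by
  constructor
  · intro h i
    have hmin : IsLocalMin (fun s => f i (deviate y i s)) (y i) :=
      Eventually.of_forall fun s => by
        simp only [deviate_self]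
        exact h i s
    have := hmin.hasDerivAt_eq_zero (hasDerivAt_deviate hf y i (y i))
    rwa [deviate_self] at this
  · intro h i s
    obtain ⟨ω, hω, hmon⟩ := hmono
    have hmul : ∀ r, 0 ≤ (r - y i) * ownGrad f i (deviate y i r) := by
      intro r
      have h1 := hmon (deviate y i r) y
      -- The two profiles differ only in coordinate `i`.
      rw [Finset.sum_eq_single i] at h1
      · rw [h i, sub_zero, deviate_apply, if_pos rfl] at h1
        exact le_trans (by positivity) h1
      · intro j _ hj
        rw [deviate_apply, if_neg hj, sub_self, zero_mul]
      · simp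
    set g : ℝ → ℝ := fun s => f i (deviate y i s) with hg
    have hder : ∀ r, HasDerivAt g (ownGrad f i (deviate y i r)) r := hasDerivAt_deviate hf y i
    have hgy : g (y i) = f i y := by simp only [hg, deviate_self]
    rw [← hgy]
    change g (y i) ≤ g s
    rcases lt_trichotomy (y i) s with hs | hs | hs
    · obtain ⟨r, hr, hr'⟩ := exists_hasDerivAt_eq_slope g _ hs
        (fun x _ => (hder x).continuousAt.continuousWithinAt) (fun x _ => hder x)
      have h2 : 0 ≤ ownGrad f i (deviate y i r) :=
        nonneg_of_mul_nonneg_right (hmul r) (by linarith [hr.1])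
      rw [hr', div_nonneg_iff] at h2
      rcases h2 with h2 | h2 <;> linarith
    · rw [hs]
    · obtain ⟨r, hr, hr'⟩ := exists_hasDerivAt_eq_slope g _ hs
        (fun x _ => (hder x).continuousAt.continuousWithinAt) (fun x _ => hder x)
      have h2 : ownGrad f i (deviate y i r) ≤ 0 := by
        by_contra! hc
        have := mul_neg_of_neg_of_pos (by linarith [hr.2] : r - y i < 0) hc
        linarith [hmul r]
      rw [hr', div_nonpos_iff] at h2
      rcases h2 with h2 | h2 <;> linarith

lemma eq_of_ownGrad_eq_zero (hmono : StronglyMonotone f) {y z : EuclideanSpace ℝ (Fin N)}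
    (hy : ∀ i, ownGrad f i y = 0) (hz : ∀ i, ownGrad f i z = 0) : y = z := by
  obtain ⟨ω, hω, hmon⟩ := hmono
  have := hmon y z
  simp only [hy, hz, sub_zero, mul_zero, Finset.sum_const_zero] at this
  have h2 : ‖y - z‖ ^ 2 ≤ 0 := by
    by_contra! hc
    have := mul_pos hω hc
    linarith
  have h3 : ‖y - z‖ = 0 := by
    have := le_antisymm h2 (sq_nonneg _)
    exact pow_eq_zero_iff two_ne_zero |>.1 this
  exact sub_eq_zero.1 (norm_eq_zero.1 h3)

end Game

/-! ### The grounded Laplacian -/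

section GroundedLaplacian

variable {N : ℕ}

/-- The Laplacian of the weights `a`, grounded by `b`. -/
def groundedLap (a : Matrix (Fin N) (Fin N) ℝ) (b e : Fin N → ℝ) (i : Fin N) : ℝ :=
  ∑ k, a i k * (e i - e k) + b i * e i

/-- The relative estimation errors, as a function of the absolute ones. -/
def consensus (a : Matrix (Fin N) (Fin N) ℝ) (e : Fin N → Fin N → ℝ) (i j : Fin N) : ℝ :=
  groundedLap a (fun k => a k j) (fun k => e k j) i

variable {a : Matrix (Fin N) (Fin N) ℝ}

/-- Summation by parts: exchange `i` and `k` using the symmetry of `a`. The right side exhibits both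
the symmetry and the nonnegativity of the form. -/
lemma sum_groundedLap_mul (ha : ∀ i j, a i j = a j i) (b e e' : Fin N → ℝ) :
    ∑ i, groundedLap a b e i * e' i
      = (∑ i, ∑ k, a i k * ((e i - e k) * (e' i - e' k))) / 2 + ∑ i, b i * (e i * e' i) := by
  have h1 : ∑ i, groundedLap a b e i * e' i
      = ∑ i, ∑ k, a i k * (e i - e k) * e' i + ∑ i, b i * (e i * e' i) := by
    rw [← Finset.sum_add_distrib]
    refine Finset.sum_congr rfl fun i _ => ?_
    rw [groundedLap, add_mul, Finset.sum_mul]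
    ring
  have h2 : ∑ i, ∑ k, a i k * (e i - e k) * e' i = -∑ i, ∑ k, a i k * (e i - e k) * e' k := by
    rw [Finset.sum_comm, ← Finset.sum_neg_distrib]
    refine Finset.sum_congr rfl fun i _ => ?_
    rw [← Finset.sum_neg_distrib]
    refine Finset.sum_congr rfl fun k _ => ?_
    rw [ha k i]
    ring
  have h3 : ∑ i, ∑ k, a i k * ((e i - e k) * (e' i - e' k))
      = ∑ i, ∑ k, a i k * (e i - e k) * e' i - ∑ i, ∑ k, a i k * (e i - e k) * e' k := by
    rw [← Finset.sum_sub_distrib]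
    refine Finset.sum_congr rfl fun i _ => ?_
    rw [← Finset.sum_sub_distrib]
    refine Finset.sum_congr rfl fun k _ => ?_
    ring
  rw [h1, h3]
  linarith

lemma sum_consensus_mul_comm (ha : ∀ i j, a i j = a j i) (e e' : Fin N → Fin N → ℝ) :
    ∑ i, ∑ j, consensus a e i j * e' i j = ∑ i, ∑ j, consensus a e' i j * e i j := by
  rw [Finset.sum_comm, Finset.sum_comm (f := fun i j => consensus a e' i j * e i j)]
  refine Finset.sum_congr rfl fun j _ => ?_
  simp only [consensus]
  rw [sum_groundedLap_mul ha _ _ (fun i => e' i j), sum_groundedLap_mul ha _ _ (fun i => e i j)]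
  simp only [mul_comm]

/-- Cauchy–Schwarz with weights `a i k`, then `(x + y)² ≤ 2x² + 2y²`. -/
lemma groundedLap_sq_le (ha0 : ∀ i j, 0 ≤ a i j) {b : Fin N → ℝ} (hb : ∀ i, 0 ≤ b i) {M : ℝ}
    (hM : ∀ i, ∑ k, a i k ≤ M) (hbM : ∀ i, b i ≤ M) (e : Fin N → ℝ) (i : Fin N) :
    groundedLap a b e i ^ 2
      ≤ 2 * M * (∑ k, a i k * ((e i - e k) * (e i - e k)) + b i * (e i * e i)) := by
  have h1 : (∑ k, a i k * (e i - e k)) ^ 2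
      ≤ (∑ k, a i k) * ∑ k, a i k * ((e i - e k) * (e i - e k)) :=
    Finset.sum_sq_le_sum_mul_sum_of_sq_le_mul _ (fun k _ => ha0 i k)
      (fun k _ => mul_nonneg (ha0 i k) (mul_self_nonneg _)) (fun k _ => le_of_eq (by ring))
  have h0 : 0 ≤ ∑ k, a i k * ((e i - e k) * (e i - e k)) :=
    Finset.sum_nonneg fun k _ => mul_nonneg (ha0 i k) (mul_self_nonneg _)
  have h2 := mul_le_mul_of_nonneg_right (hM i) h0
  have h3 := mul_le_mul_of_nonneg_right (hbM i) (mul_nonneg (hb i) (mul_self_nonneg (e i)))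
  have h4 : groundedLap a b e i ^ 2
      ≤ 2 * (∑ k, a i k * (e i - e k)) ^ 2 + 2 * (b i * (b i * (e i * e i))) := by
    rw [groundedLap]
    have := sq_nonneg (∑ k, a i k * (e i - e k) - b i * e i)
    nlinarith
  linarith

/-- Bounds `ξ` by the energy term of the Lyapunov function. The factor 4 is the 2 of
`groundedLap_sq_le` times the 2 that undoes the halved edge sum. -/
lemma exists_sum_consensus_sq_le (ha : ∀ i j, a i j = a j i) (ha0 : ∀ i j, 0 ≤ a i j) :
    ∃ M : ℝ, 0 ≤ M ∧ ∀ e : Fin N → Fin N → ℝ,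
      ∑ i, ∑ j, consensus a e i j ^ 2 ≤ M * ∑ i, ∑ j, consensus a e i j * e i j := by
  set M := ∑ i, ∑ k, a i k with hMdef
  have hM : ∀ i, ∑ k, a i k ≤ M := fun i =>
    Finset.single_le_sum (f := fun i => ∑ k, a i k)
      (fun i _ => Finset.sum_nonneg fun k _ => ha0 i k) (Finset.mem_univ i)
  have haM : ∀ i j, a i j ≤ M := fun i j =>
    (Finset.single_le_sum (fun k _ => ha0 i k) (Finset.mem_univ j)).trans (hM i)
  have hM0 : 0 ≤ M := Finset.sum_nonneg fun i _ => Finset.sum_nonneg fun k _ => ha0 i k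
  refine ⟨4 * M, by positivity, fun e => ?_⟩
  rw [Finset.sum_comm, Finset.sum_comm (f := fun i j => consensus a e i j * e i j),
    Finset.mul_sum]
  refine Finset.sum_le_sum fun j _ => ?_
  simp only [consensus]
  rw [sum_groundedLap_mul ha _ _ (fun i => e i j)]
  have h1 := Finset.sum_le_sum fun i (_ : i ∈ Finset.univ) =>
    groundedLap_sq_le ha0 (b := fun k => a k j) (fun k => ha0 k j) hM (fun k => haM k j)
      (fun k => e k j) i
  rw [← Finset.mul_sum, Finset.sum_add_distrib] at h1
  have h2 : 0 ≤ M * ∑ i, a i j * (e i j * e i j) :=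
    mul_nonneg hM0 (Finset.sum_nonneg fun i _ => mul_nonneg (ha0 i j) (mul_self_nonneg _))
  linarith

lemma sum_consensus_mul_self_nonneg (ha : ∀ i j, a i j = a j i) (ha0 : ∀ i j, 0 ≤ a i j)
    (e : Fin N → Fin N → ℝ) : 0 ≤ ∑ i, ∑ j, consensus a e i j * e i j := by
  rw [Finset.sum_comm]
  refine Finset.sum_nonneg fun j _ => ?_
  simp only [consensus]
  rw [sum_groundedLap_mul ha _ _ (fun i => e i j)]
  have h1 : 0 ≤ ∑ i, ∑ k, a i k * ((e i j - e k j) * (e i j - e k j)) :=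
    Finset.sum_nonneg fun i _ => Finset.sum_nonneg fun k _ =>
      mul_nonneg (ha0 i k) (mul_self_nonneg _)
  have h2 : 0 ≤ ∑ i, a i j * (e i j * e i j) :=
    Finset.sum_nonneg fun i _ => mul_nonneg (ha0 i j) (mul_self_nonneg _)
  linarith

lemma IsWeightedAdjacency.nonneg {G : SimpleGraph (Fin N)} (h : IsWeightedAdjacency G a)
    (i j : Fin N) : 0 ≤ a i j := by
  by_cases hij : G.Adj i j
  · exact (h.pos i j hij).le
  · exact (h.zero i j hij).ge

/-- The energy is a sum of nonnegative terms, hence each is zero: `e` is constant along edges and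
vanishes at the grounded vertex `i₀`, so connectedness finishes. -/
lemma eq_zero_of_groundedLap_eq_zero {G : SimpleGraph (Fin N)} (hG : G.Connected)
    (h : IsWeightedAdjacency G a) {b e : Fin N → ℝ} (hb : ∀ i, 0 ≤ b i) {i₀ : Fin N}
    (hb0 : 0 < b i₀) (he : ∀ i, groundedLap a b e i = 0) : e = 0 := by
  have h0 := sum_groundedLap_mul h.symm b e e
  simp only [he, zero_mul, Finset.sum_const_zero] at h0
  have n1 : ∀ i k, 0 ≤ a i k * ((e i - e k) * (e i - e k)) := fun i k =>
    mul_nonneg (h.nonneg i k) (mul_self_nonneg _)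
  have n2 : ∀ i, 0 ≤ b i * (e i * e i) := fun i => mul_nonneg (hb i) (mul_self_nonneg _)
  have s1 : 0 ≤ ∑ i, ∑ k, a i k * ((e i - e k) * (e i - e k)) :=
    Finset.sum_nonneg fun i _ => Finset.sum_nonneg fun k _ => n1 i k
  have s2 : 0 ≤ ∑ i, b i * (e i * e i) := Finset.sum_nonneg fun i _ => n2 i
  have z1 : ∑ i, ∑ k, a i k * ((e i - e k) * (e i - e k)) = 0 := by linarith
  have z2 : ∑ i, b i * (e i * e i) = 0 := by linarith
  have hadj : ∀ i k, G.Adj i k → e i = e k := by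
    intro i k hik
    have h1 := (Finset.sum_eq_zero_iff_of_nonneg fun i _ =>
      Finset.sum_nonneg fun k _ => n1 i k).1 z1 i (Finset.mem_univ i)
    have h2 := (Finset.sum_eq_zero_iff_of_nonneg fun k _ => n1 i k).1 h1 k (Finset.mem_univ k)
    have h3 := (mul_eq_zero.1 h2).resolve_left (h.pos i k hik).ne'
    exact sub_eq_zero.1 (mul_self_eq_zero.1 h3)
  have hi₀ : e i₀ = 0 := by
    have h1 := (Finset.sum_eq_zero_iff_of_nonneg fun i _ => n2 i).1 z2 i₀ (Finset.mem_univ i₀)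
    exact mul_self_eq_zero.1 ((mul_eq_zero.1 h1).resolve_left hb0.ne')
  have hwalk : ∀ i k, G.Walk i k → e i = e k := by
    intro i k p
    induction p with
    | nil => rfl
    | cons hh _ ih => exact (hadj _ _ hh).trans ih
  funext i
  obtain ⟨p⟩ := hG.preconnected i i₀
  rw [hwalk i i₀ p, hi₀]
  rfl

/-- `consensus` as a linear map. -/
def consensusLin (a : Matrix (Fin N) (Fin N) ℝ) :
    (Fin N → Fin N → ℝ) →ₗ[ℝ] (Fin N → Fin N → ℝ) where
  toFun e i j := consensus a e i j
  map_add' e e' := by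
    funext i j
    simp only [consensus, groundedLap, Pi.add_apply]
    have : ∑ k, a i k * (e i j + e' i j - (e k j + e' k j))
        = ∑ k, a i k * (e i j - e k j) + ∑ k, a i k * (e' i j - e' k j) := by
      rw [← Finset.sum_add_distrib]
      exact Finset.sum_congr rfl fun k _ => by ring
    rw [this]
    ring
  map_smul' r e := by
    funext i j
    simp only [consensus, groundedLap, Pi.smul_apply, smul_eq_mul, RingHom.id_apply]
    rw [mul_add, Finset.mul_sum]
    congr 1
    · exact Finset.sum_congr rfl fun k _ => by ring
    · ring

/-- The map from errors to `ξ` is linear and injective in finite dimension, hence bounded below. -/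
lemma exists_error_sq_le (hN : 1 < N) {G : SimpleGraph (Fin N)} (hG : G.Connected)
    (h : IsWeightedAdjacency G a) :
    ∃ κ : ℝ, 0 < κ ∧ ∀ (e : Fin N → Fin N → ℝ) (i j : Fin N),
      e i j ^ 2 ≤ κ ^ 2 * ∑ i, ∑ j, consensus a e i j ^ 2 := by
  have : Nontrivial (Fin N) := Fin.nontrivial_iff_two_le.2 hN
  have hker : LinearMap.ker (consensusLin a) = ⊥ := by
    rw [LinearMap.ker_eq_bot']
    intro e he
    funext i j
    -- Vertex `j` has a neighbour because `N > 1`; there the weight `a i₀ j` grounds the Laplacian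
    -- of column `j`.
    obtain ⟨i₀, hi₀⟩ := hG.preconnected.exists_adj_of_nontrivial j
    have := eq_zero_of_groundedLap_eq_zero hG h (b := fun k => a k j) (e := fun k => e k j)
      (fun k => h.nonneg k j) (h.pos i₀ j hi₀.symm)
      (fun i => congrFun (congrFun he i) j)
    exact congrFun this i
  obtain ⟨K, hK, hanti⟩ := (consensusLin a).exists_antilipschitzWith hker
  refine ⟨K, hK, fun e i j => ?_⟩
  have h1 : ‖e‖ ≤ K * ‖consensusLin a e‖ := by
    have := hanti.le_mul_dist e 0
    simpa using this
  have h2 : ‖consensusLin a e‖ ≤ √(∑ i, ∑ j, consensus a e i j ^ 2) := by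
    refine (pi_norm_le_iff_of_nonneg (Real.sqrt_nonneg _)).2 fun i => ?_
    refine (pi_norm_le_iff_of_nonneg (Real.sqrt_nonneg _)).2 fun j => ?_
    refine Real.abs_le_sqrt ?_
    have h3 := Finset.single_le_sum (f := fun j => consensus a e i j ^ 2)
      (fun j _ => sq_nonneg _) (Finset.mem_univ j)
    have h4 := Finset.single_le_sum (f := fun i => ∑ j, consensus a e i j ^ 2)
      (fun i _ => Finset.sum_nonneg fun j _ => sq_nonneg _) (Finset.mem_univ i)
    exact h3.trans h4
  have h3 : |e i j| ≤ ‖e‖ := (norm_le_pi_norm (e i) j).trans (norm_le_pi_norm e i)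
  have h4 : |e i j| ≤ K * √(∑ i, ∑ j, consensus a e i j ^ 2) :=
    h3.trans (h1.trans (by gcongr))
  have hs : 0 ≤ ∑ i, ∑ j, consensus a e i j ^ 2 :=
    Finset.sum_nonneg fun i _ => Finset.sum_nonneg fun j _ => sq_nonneg _
  calc e i j ^ 2 = |e i j| ^ 2 := (sq_abs _).symm
    _ ≤ (K * √(∑ i, ∑ j, consensus a e i j ^ 2)) ^ 2 := by gcongr
    _ = _ := by rw [mul_pow, Real.sq_sqrt hs]

end GroundedLaplacian

/-! ### The estimator and its Lyapunov function -/

section Estimator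

variable {N : ℕ}

/-- States `(w, z, c)` of the estimator: integrated gradients, estimates and adaptive gains. -/
abbrev EstState (N : ℕ) : Type :=
  (Fin N → ℝ) × (Fin N → EuclideanSpace ℝ (Fin N)) × (Fin N → Fin N → ℝ)

/-- The estimation errors `zᵢⱼ + wⱼ`. -/
def EstState.err (s : EstState N) (i j : Fin N) : ℝ := s.2.1 i j + s.1 j

/-- The relative errors `ξᵢⱼ`. -/
def EstState.xi (a : Matrix (Fin N) (Fin N) ℝ) (s : EstState N) (i j : Fin N) : ℝ :=
  consensus a s.err i j

/-- The right-hand side of the estimator. -/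
noncomputable def estField (f : Fin N → EuclideanSpace ℝ (Fin N) → ℝ) (a : Matrix (Fin N) (Fin N) ℝ)
    (s : EstState N) : EstState N :=
  (fun j => ownGrad f j (s.2.1 j), fun i => WithLp.toLp 2 fun j => -(s.2.2 i j * s.xi a i j),
    fun i j => s.xi a i j ^ 2)

/-- The Lyapunov function, relative to the equilibrium `ys` and a gain `g`. -/
noncomputable def lyap (a : Matrix (Fin N) (Fin N) ℝ) (ys : EuclideanSpace ℝ (Fin N)) (g : ℝ)
    (s : EstState N) : ℝ :=
  (∑ j, (s.1 j + ys j) ^ 2) / 2 + (∑ i, ∑ j, s.xi a i j * s.err i j) / 2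
    + (∑ i, ∑ j, (s.2.2 i j - g) ^ 2) / 2

/-- The derivative of the Lyapunov function along the estimator. -/
noncomputable def lyapDeriv (f : Fin N → EuclideanSpace ℝ (Fin N) → ℝ) (a : Matrix (Fin N) (Fin N) ℝ)
    (ys : EuclideanSpace ℝ (Fin N)) (g : ℝ) (s : EstState N) : ℝ :=
  ∑ j, (s.1 j + ys j) * ownGrad f j (s.2.1 j)
    + ∑ i, ∑ j, s.xi a i j * (-(s.2.2 i j * s.xi a i j) + ownGrad f j (s.2.1 j))
    + ∑ i, ∑ j, (s.2.2 i j - g) * s.xi a i j ^ 2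

variable {f : Fin N → EuclideanSpace ℝ (Fin N) → ℝ} {a : Matrix (Fin N) (Fin N) ℝ}

lemma hasDerivWithinAt_consensus {e e' : Fin N → Fin N → ℝ → ℝ} {S : Set ℝ} {t : ℝ}
    (h : ∀ i j, HasDerivWithinAt (e i j) (e' i j t) S t) (i j : Fin N) :
    HasDerivWithinAt (fun t => consensus a (fun i j => e i j t) i j)
      (consensus a (fun i j => e' i j t) i j) S t := by
  simp only [consensus, groundedLap]
  refine HasDerivWithinAt.fun_add (HasDerivWithinAt.fun_sum fun k _ => ?_) ((h i j).const_mul _)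
  exact ((h i j).fun_sub (h k j)).const_mul _

/-- Chain rule for the Lyapunov function along a rescaled estimator. -/
lemma hasDerivWithinAt_lyap (ha : ∀ i j, a i j = a j i) (ys : EuclideanSpace ℝ (Fin N)) (g : ℝ)
    {s : ℝ → EstState N} {χ t : ℝ} {S : Set ℝ}
    (hw : ∀ j, HasDerivWithinAt (fun t => (s t).1 j) (χ * ownGrad f j ((s t).2.1 j)) S t)
    (hz : ∀ i j, HasDerivWithinAt (fun t => (s t).2.1 i j)
      (χ * -((s t).2.2 i j * (s t).xi a i j)) S t)
    (hc : ∀ i j, HasDerivWithinAt (fun t => (s t).2.2 i j) (χ * (s t).xi a i j ^ 2) S t) :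
    HasDerivWithinAt (fun t => lyap a ys g (s t)) (χ * lyapDeriv f a ys g (s t)) S t := by
  have he : ∀ i j, HasDerivWithinAt (fun t => (s t).err i j)
      (χ * (-((s t).2.2 i j * (s t).xi a i j) + ownGrad f j ((s t).2.1 j))) S t := by
    intro i j
    rw [mul_add]
    exact (hz i j).fun_add (hw j)
  set e' : Fin N → Fin N → ℝ := fun i j =>
    χ * (-((s t).2.2 i j * (s t).xi a i j) + ownGrad f j ((s t).2.1 j)) with he'
  have hxi : ∀ i j, HasDerivWithinAt (fun t => (s t).xi a i j) (consensus a e' i j) S t :=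
    hasDerivWithinAt_consensus (e := fun i j t => (s t).err i j) (e' := fun i j _ => e' i j) he
  have h1 : HasDerivWithinAt (fun t => (∑ j, ((s t).1 j + ys j) ^ 2) / 2)
      (∑ j, χ * (((s t).1 j + ys j) * ownGrad f j ((s t).2.1 j))) S t := by
    have := (HasDerivWithinAt.fun_sum (u := Finset.univ) fun j _ =>
      ((hw j).add_const (ys j)).fun_pow 2).div_const 2
    refine this.congr_deriv ?_
    rw [Finset.sum_div]
    refine Finset.sum_congr rfl fun j _ => ?_
    simp
    ring
  have h2 : HasDerivWithinAt (fun t => (∑ i, ∑ j, (s t).xi a i j * (s t).err i j) / 2)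
      (∑ i, ∑ j, χ * ((s t).xi a i j
        * (-((s t).2.2 i j * (s t).xi a i j) + ownGrad f j ((s t).2.1 j)))) S t := by
    have := (HasDerivWithinAt.fun_sum (u := Finset.univ) fun i _ =>
      HasDerivWithinAt.fun_sum (u := Finset.univ) fun j _ =>
        (hxi i j).fun_mul (he i j)).div_const 2
    refine this.congr_deriv ?_
    -- By symmetry of the Laplacian the two halves of the product rule agree.
    have hsym : ∑ i, ∑ j, consensus a e' i j * (s t).err i j
        = ∑ i, ∑ j, (s t).xi a i j * e' i j :=
      sum_consensus_mul_comm ha e' (s t).err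
    simp only [Finset.sum_add_distrib]
    rw [hsym]
    change (∑ i, ∑ j, (s t).xi a i j * e' i j + ∑ i, ∑ j, (s t).xi a i j * e' i j) / 2 = _
    rw [add_self_div_two]
    refine Finset.sum_congr rfl fun i _ => Finset.sum_congr rfl fun j _ => ?_
    simp only [he']
    ring
  have h3 : HasDerivWithinAt (fun t => (∑ i, ∑ j, ((s t).2.2 i j - g) ^ 2) / 2)
      (∑ i, ∑ j, χ * (((s t).2.2 i j - g) * (s t).xi a i j ^ 2)) S t := by
    have := (HasDerivWithinAt.fun_sum (u := Finset.univ) fun i _ =>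
      HasDerivWithinAt.fun_sum (u := Finset.univ) fun j _ =>
        ((hc i j).sub_const g).fun_pow 2).div_const 2
    refine this.congr_deriv ?_
    rw [Finset.sum_div]
    refine Finset.sum_congr rfl fun i _ => ?_
    rw [Finset.sum_div]
    refine Finset.sum_congr rfl fun j _ => ?_
    simp
    ring
  have h := (h1.fun_add h2).fun_add h3
  refine h.congr_deriv ?_
  simp only [lyapDeriv, mul_add, Finset.mul_sum]

lemma abs_le_sqrt_sum_sq {ι : Type*} [Fintype ι] (r : ι → ℝ) (j : ι) :
    |r j| ≤ √(∑ j, r j ^ 2) :=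
  Real.abs_le_sqrt (Finset.single_le_sum (f := fun j => r j ^ 2) (fun _ _ => sq_nonneg _)
    (Finset.mem_univ j))

/-- For a large gain, the Lyapunov function decreases strictly along the estimator. -/
theorem exists_lyapDeriv_le (hN : 1 < N) (hf : SmoothLipschitz f) (hmono : StronglyMonotone f)
    {G : SimpleGraph (Fin N)} (hG : G.Connected) (ha : IsWeightedAdjacency G a)
    {ys : EuclideanSpace ℝ (Fin N)} (hys : ∀ i, ownGrad f i ys = 0) :
    ∃ (g κ : ℝ), 0 < κ ∧ ∀ s : EstState N, lyapDeriv f a ys g s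
      ≤ -(κ * (∑ j, (s.1 j + ys j) ^ 2 + ∑ i, ∑ j, s.xi a i j ^ 2)) := by
  obtain ⟨l, hl, hlip⟩ := hf.exists_uniform
  obtain ⟨ω, hω, hmon⟩ := hmono
  obtain ⟨κ, hκ, herr⟩ := exists_error_sq_le hN hG ha
  set κ' := N * κ with hκ'
  have hNr : (1 : ℝ) ≤ N := by exact_mod_cast hN.le
  have hκ'0 : 0 < κ' := by positivity
  -- `α` and `β` are the coefficients of `R * X` and `X ^ 2` in the cross terms. The gain pays for
  -- `β`, for the `X ^ 2` share of Young's inequality applied to `α * R * X`, and leaves 1.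
  set α := N * l * κ' + N * N * l with hα
  set β := N * N * l * κ' with hβ
  refine ⟨β + α ^ 2 / (2 * ω) + 1, min (ω / 2) 1, by positivity, fun s => ?_⟩
  set R := √(∑ j, (s.1 j + ys j) ^ 2) with hR
  set X := √(∑ i, ∑ j, s.xi a i j ^ 2) with hX
  have hR0 : 0 ≤ R := Real.sqrt_nonneg _
  have hX0 : 0 ≤ X := Real.sqrt_nonneg _
  have hR2 : R ^ 2 = ∑ j, (s.1 j + ys j) ^ 2 :=
    Real.sq_sqrt (Finset.sum_nonneg fun j _ => sq_nonneg _)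
  have hX2 : X ^ 2 = ∑ i, ∑ j, s.xi a i j ^ 2 :=
    Real.sq_sqrt (Finset.sum_nonneg fun i _ => Finset.sum_nonneg fun j _ => sq_nonneg _)
  have hr : ∀ j, |s.1 j + ys j| ≤ R := abs_le_sqrt_sum_sq fun j => s.1 j + ys j
  have hξ : ∀ i j, |s.xi a i j| ≤ X := by
    intro i j
    refine Real.abs_le_sqrt ?_
    have h3 := Finset.single_le_sum (f := fun j => s.xi a i j ^ 2)
      (fun j _ => sq_nonneg _) (Finset.mem_univ j)
    have h4 := Finset.single_le_sum (f := fun i => ∑ j, s.xi a i j ^ 2)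
      (fun i _ => Finset.sum_nonneg fun j _ => sq_nonneg _) (Finset.mem_univ i)
    exact h3.trans h4
  -- The profile `v = -w` is what all players estimate; monotonicity is applied at `v`, and `z j -
  -- v` is an error term.
  set v : EuclideanSpace ℝ (Fin N) := WithLp.toLp 2 fun j => -s.1 j with hv
  have hzv : ∀ j, ‖s.2.1 j - v‖ ≤ κ' * X := by
    intro j
    refine le_of_sq_le_sq ?_ (by positivity)
    rw [EuclideanSpace.real_norm_sq_eq]
    have h1 : ∀ k ∈ Finset.univ, ((s.2.1 j - v) k) ^ 2 ≤ κ ^ 2 * X ^ 2 := by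
      intro k _
      have h2 : (s.2.1 j - v) k = s.err j k := by simp [hv, EstState.err]
      rw [h2, hX2]
      exact herr s.err j k
    have h2 := Finset.sum_le_card_nsmul _ _ _ h1
    simp only [Finset.card_univ, Fintype.card_fin, nsmul_eq_mul] at h2
    refine h2.trans ?_
    rw [hκ', mul_pow, mul_pow, mul_assoc]
    have h3 : (N : ℝ) ≤ N ^ 2 := by nlinarith
    gcongr
  have hvy : ‖v - ys‖ = R := by
    rw [EuclideanSpace.norm_eq, hR]
    congr 1
    refine Finset.sum_congr rfl fun j _ => ?_
    rw [Real.norm_eq_abs, sq_abs]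
    simp only [hv, PiLp.sub_apply]
    ring
  have hg1 : ∀ j, |ownGrad f j (s.2.1 j) - ownGrad f j v| ≤ l * (κ' * X) := fun j =>
    (hlip j _ _).trans (mul_le_mul_of_nonneg_left (hzv j) hl.le)
  have hg2 : ∀ j, |ownGrad f j v| ≤ l * R := fun j => by
    have := hlip j v ys
    rwa [hys, sub_zero, hvy] at this
  have hg3 : ∀ j, |ownGrad f j (s.2.1 j)| ≤ l * (R + κ' * X) := fun j => by
    have := abs_sub_abs_le_abs_sub (ownGrad f j (s.2.1 j)) (ownGrad f j v)
    have := hg1 j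
    have := hg2 j
    linarith
  have hA : ∑ j, (s.1 j + ys j) * ownGrad f j v ≤ -(ω * R ^ 2) := by
    have h1 := hmon v ys
    rw [hvy] at h1
    have h2 : ∑ j, (v j - ys j) * (ownGrad f j v - ownGrad f j ys)
        = -∑ j, (s.1 j + ys j) * ownGrad f j v := by
      rw [← Finset.sum_neg_distrib]
      refine Finset.sum_congr rfl fun j _ => ?_
      rw [hys]
      simp only [hv]
      ring
    linarith
  have hB : ∑ j, (s.1 j + ys j) * (ownGrad f j (s.2.1 j) - ownGrad f j v)
      ≤ N * (R * (l * (κ' * X))) := by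
    have : ∀ j ∈ Finset.univ, (s.1 j + ys j) * (ownGrad f j (s.2.1 j) - ownGrad f j v)
        ≤ R * (l * (κ' * X)) := fun j _ => by
      refine (le_abs_self _).trans ?_
      rw [abs_mul]
      exact mul_le_mul (hr j) (hg1 j) (abs_nonneg _) hR0
    simpa using Finset.sum_le_card_nsmul _ _ _ this
  have hC : ∑ i, ∑ j, s.xi a i j * ownGrad f j (s.2.1 j)
      ≤ N * (N * (X * (l * (R + κ' * X)))) := by
    have h1 : ∀ i ∈ Finset.univ, ∑ j, s.xi a i j * ownGrad f j (s.2.1 j)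
        ≤ N * (X * (l * (R + κ' * X))) := fun i _ => by
      have : ∀ j ∈ Finset.univ, s.xi a i j * ownGrad f j (s.2.1 j)
          ≤ X * (l * (R + κ' * X)) := fun j _ => by
        refine (le_abs_self _).trans ?_
        rw [abs_mul]
        exact mul_le_mul (hξ i j) (hg3 j) (abs_nonneg _) hX0
      simpa using Finset.sum_le_card_nsmul _ _ _ this
    simpa using Finset.sum_le_card_nsmul _ _ _ h1
  set g := β + α ^ 2 / (2 * ω) + 1 with hg
  -- The actual gains cancel: `-c ξ² + (c - g) ξ² = -g ξ²`.
  have hD : lyapDeriv f a ys g s = ∑ j, (s.1 j + ys j) * ownGrad f j v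
      + ∑ j, (s.1 j + ys j) * (ownGrad f j (s.2.1 j) - ownGrad f j v)
      + ∑ i, ∑ j, s.xi a i j * ownGrad f j (s.2.1 j) - g * X ^ 2 := by
    have e1 : ∑ j, (s.1 j + ys j) * ownGrad f j (s.2.1 j)
        = ∑ j, (s.1 j + ys j) * ownGrad f j v
          + ∑ j, (s.1 j + ys j) * (ownGrad f j (s.2.1 j) - ownGrad f j v) := by
      rw [← Finset.sum_add_distrib]
      exact Finset.sum_congr rfl fun j _ => by ring
    have e2 : ∑ i, ∑ j, s.xi a i j * (-(s.2.2 i j * s.xi a i j) + ownGrad f j (s.2.1 j))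
          + ∑ i, ∑ j, (s.2.2 i j - g) * s.xi a i j ^ 2
        = ∑ i, ∑ j, s.xi a i j * ownGrad f j (s.2.1 j) - g * X ^ 2 := by
      rw [hX2, Finset.mul_sum, ← Finset.sum_add_distrib, ← Finset.sum_sub_distrib]
      refine Finset.sum_congr rfl fun i _ => ?_
      rw [Finset.mul_sum, ← Finset.sum_add_distrib, ← Finset.sum_sub_distrib]
      exact Finset.sum_congr rfl fun j _ => by ring
    rw [lyapDeriv, e1, add_assoc, e2, add_sub_assoc]
  have hyoung : α * R * X ≤ ω / 2 * R ^ 2 + α ^ 2 / (2 * ω) * X ^ 2 := by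
    have h1 : ω / 2 * R ^ 2 + α ^ 2 / (2 * ω) * X ^ 2 - α * R * X
        = (ω * R - α * X) ^ 2 / (2 * ω) := by
      field_simp
      ring
    have h2 : 0 ≤ (ω * R - α * X) ^ 2 / (2 * ω) := by positivity
    linarith
  have hsum : N * (R * (l * (κ' * X))) + N * (N * (X * (l * (R + κ' * X))))
      = α * R * X + β * X ^ 2 := by
    rw [hα, hβ]; ring
  have hfin : lyapDeriv f a ys g s ≤ -(ω / 2 * R ^ 2) - X ^ 2 := by
    rw [hD, hg]
    linarith
  have hm1 : min (ω / 2) 1 * R ^ 2 ≤ ω / 2 * R ^ 2 := by gcongr; exact min_le_left _ _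
  have hm2 : min (ω / 2) 1 * X ^ 2 ≤ 1 * X ^ 2 := by gcongr; exact min_le_right _ _
  rw [← hR2, ← hX2]
  linarith

lemma lyap_nonneg (ha : ∀ i j, a i j = a j i) (ha0 : ∀ i j, 0 ≤ a i j)
    (ys : EuclideanSpace ℝ (Fin N)) (g : ℝ) (s : EstState N) : 0 ≤ lyap a ys g s := by
  have h1 : 0 ≤ ∑ j, (s.1 j + ys j) ^ 2 := Finset.sum_nonneg fun j _ => sq_nonneg _
  have h2 : 0 ≤ ∑ i, ∑ j, s.xi a i j * s.err i j := sum_consensus_mul_self_nonneg ha ha0 s.err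
  have h3 : 0 ≤ ∑ i, ∑ j, (s.2.2 i j - g) ^ 2 :=
    Finset.sum_nonneg fun i _ => Finset.sum_nonneg fun j _ => sq_nonneg _
  unfold lyap
  linarith

/-- The sublevel sets of the Lyapunov function are bounded. -/
theorem exists_norm_le_of_lyap_le (hN : 1 < N)
    {G : SimpleGraph (Fin N)} (hG : G.Connected) (ha : IsWeightedAdjacency G a)
    (ys : EuclideanSpace ℝ (Fin N)) (g C : ℝ) :
    ∃ R : ℝ, ∀ s : EstState N, lyap a ys g s ≤ C → ‖s‖ ≤ R := by
  obtain ⟨κ, hκ, herr⟩ := exists_error_sq_le hN hG ha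
  obtain ⟨M, hM, hMle⟩ := exists_sum_consensus_sq_le ha.symm ha.nonneg
  set Rw := √(2 * C) + ‖ys‖ with hRw
  set Rz := N * (√(κ ^ 2 * (M * (2 * C))) + Rw) with hRz
  set Rc := √(2 * C) + |g| with hRc
  have hNr : (1 : ℝ) ≤ N := by exact_mod_cast hN.le
  refine ⟨max Rw (max Rz Rc), fun s hs => ?_⟩
  have h1 : 0 ≤ ∑ j, (s.1 j + ys j) ^ 2 := Finset.sum_nonneg fun j _ => sq_nonneg _
  have h2 : 0 ≤ ∑ i, ∑ j, s.xi a i j * s.err i j :=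
    sum_consensus_mul_self_nonneg ha.symm ha.nonneg s.err
  have h3 : 0 ≤ ∑ i, ∑ j, (s.2.2 i j - g) ^ 2 :=
    Finset.sum_nonneg fun i _ => Finset.sum_nonneg fun j _ => sq_nonneg _
  unfold lyap at hs
  have hRw0 : 0 ≤ Rw := by positivity
  have hw : ∀ j, |s.1 j| ≤ Rw := by
    intro j
    have h4 : |s.1 j + ys j| ≤ √(2 * C) :=
      (abs_le_sqrt_sum_sq (fun j => s.1 j + ys j) j).trans (Real.sqrt_le_sqrt (by linarith))
    have h5 : |ys j| ≤ ‖ys‖ := PiLp.norm_apply_le ys j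
    have h6 := abs_sub (s.1 j + ys j) (ys j)
    rw [add_sub_cancel_right] at h6
    linarith
  -- The energy bounds `ξ` through `M`, and `ξ` bounds the errors through `κ`.
  have he : ∀ i j, |s.err i j| ≤ √(κ ^ 2 * (M * (2 * C))) := by
    intro i j
    refine Real.abs_le_sqrt ((herr s.err i j).trans ?_)
    have h4 : ∑ i, ∑ j, consensus a s.err i j ^ 2 ≤ M * (2 * C) := by
      refine (hMle s.err).trans ?_
      change M * (∑ i, ∑ j, s.xi a i j * s.err i j) ≤ _
      gcongr
      linarith
    gcongr
  have hz : ∀ i, ‖s.2.1 i‖ ≤ Rz := by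
    intro i
    refine le_of_sq_le_sq ?_ (by positivity)
    rw [EuclideanSpace.real_norm_sq_eq, hRz, mul_pow]
    have h4 : ∀ j ∈ Finset.univ, s.2.1 i j ^ 2 ≤ (√(κ ^ 2 * (M * (2 * C))) + Rw) ^ 2 := by
      intro j _
      rw [← sq_abs]
      have h5 : s.2.1 i j = s.err i j - s.1 j := by simp [EstState.err]
      have h6 := abs_sub (s.err i j) (s.1 j)
      rw [← h5] at h6
      have := he i j
      have := hw j
      gcongr
      linarith
    have h5 := Finset.sum_le_card_nsmul _ _ _ h4
    simp only [Finset.card_univ, Fintype.card_fin, nsmul_eq_mul] at h5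
    refine h5.trans ?_
    have h3 : (N : ℝ) ≤ N ^ 2 := by nlinarith
    gcongr
  have hc : ∀ i j, |s.2.2 i j| ≤ Rc := by
    intro i j
    have h4 : |s.2.2 i j - g| ≤ √(2 * C) := by
      refine Real.abs_le_sqrt ?_
      have h5 := Finset.single_le_sum (f := fun j => (s.2.2 i j - g) ^ 2)
        (fun j _ => sq_nonneg _) (Finset.mem_univ j)
      have h6 := Finset.single_le_sum (f := fun i => ∑ j, (s.2.2 i j - g) ^ 2)
        (fun i _ => Finset.sum_nonneg fun j _ => sq_nonneg _) (Finset.mem_univ i)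
      have h7 := h5.trans h6
      linarith
    have h5 := abs_sub_abs_le_abs_sub (s.2.2 i j) g
    linarith
  refine norm_prod_le_iff.2 ⟨?_, norm_prod_le_iff.2 ⟨?_, ?_⟩⟩
  · exact ((pi_norm_le_iff_of_nonneg hRw0).2 hw).trans (le_max_left _ _)
  · exact ((pi_norm_le_iff_of_nonneg (by positivity)).2 hz).trans
      ((le_max_left _ _).trans (le_max_right _ _))
  · have hRc0 : 0 ≤ Rc := by positivity
    exact ((pi_norm_le_iff_of_nonneg hRc0).2 fun i =>
      (pi_norm_le_iff_of_nonneg hRc0).2 fun j => hc i j).trans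
      ((le_max_right _ _).trans (le_max_right _ _))

end Estimator

/-! ### Lipschitz right-hand sides -/

section Lipschitz

variable {E F : Type*} [NormedAddCommGroup E]

lemma exists_lipschitzWith_add {g h : E → ℝ} (hg : ∃ K, LipschitzWith K g)
    (hh : ∃ K, LipschitzWith K h) : ∃ K, LipschitzWith K fun x => g x + h x := by
  obtain ⟨K, hK⟩ := hg
  obtain ⟨L, hL⟩ := hh
  exact ⟨K + L, hK.add hL⟩

lemma exists_lipschitzWith_const_mul {g : E → ℝ} (r : ℝ) (hg : ∃ K, LipschitzWith K g) :
    ∃ K, LipschitzWith K fun x => r * g x := by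
  obtain ⟨K, hK⟩ := hg
  exact ⟨‖r‖₊ * K, (lipschitzWith_smul r).comp hK⟩

lemma exists_lipschitzWith_sum {ι : Type*} (S : Finset ι) {g : ι → E → ℝ}
    (hg : ∀ i, ∃ K, LipschitzWith K (g i)) : ∃ K, LipschitzWith K fun x => ∑ i ∈ S, g i x := by
  choose K hK using hg
  refine ⟨∑ i ∈ S, K i, LipschitzWith.of_dist_le_mul fun x y => ?_⟩
  push_cast
  rw [Finset.sum_mul]
  exact (dist_sum_sum_le S _ _).trans (Finset.sum_le_sum fun i _ => (hK i).dist_le_mul x y)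

lemma exists_lipschitzWith_pi {ι : Type*} [Fintype ι] {G : ι → Type*}
    [∀ i, PseudoMetricSpace (G i)] {g : E → ∀ i, G i}
    (hg : ∀ i, ∃ K, LipschitzWith K fun x => g x i) : ∃ K, LipschitzWith K g := by
  choose K hK using hg
  refine ⟨∑ i, K i, LipschitzWith.of_dist_le_mul fun x y => ?_⟩
  refine (dist_pi_le_iff (by positivity)).2 fun i => ((hK i).dist_le_mul x y).trans ?_
  have : K i ≤ ∑ i, K i := Finset.single_le_sum (fun _ _ => zero_le) (Finset.mem_univ i)
  gcongr

lemma locallyLipschitz_pi {ι : Type*} [Fintype ι] {G : ι → Type*}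
    [∀ i, PseudoMetricSpace (G i)] {g : E → ∀ i, G i}
    (hg : ∀ i, LocallyLipschitz fun x => g x i) : LocallyLipschitz g := by
  intro x
  choose K t ht hK using fun i => hg i x
  refine ⟨∑ i, K i, ⋂ i, t i, Filter.iInter_mem.2 ht, ?_⟩
  refine LipschitzOnWith.of_dist_le_mul fun y hy z hz => ?_
  refine (dist_pi_le_iff (by positivity)).2 fun i =>
    ((hK i).dist_le_mul y (mem_iInter.1 hy i) z (mem_iInter.1 hz i)).trans ?_
  have : K i ≤ ∑ i, K i := Finset.single_le_sum (fun _ _ => zero_le) (Finset.mem_univ i)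
  gcongr

/-- A Lipschitz cutoff function, equal to one on the ball of radius `R`. -/
def cutoff (R : ℝ) (x : E) : ℝ := max 0 (min 1 (R + 1 - ‖x‖))

lemma cutoff_nonneg (R : ℝ) (x : E) : 0 ≤ cutoff R x := le_max_left _ _

lemma cutoff_le_one (R : ℝ) (x : E) : cutoff R x ≤ 1 :=
  max_le zero_le_one (min_le_left _ _)

lemma cutoff_eq_one {R : ℝ} {x : E} (h : ‖x‖ ≤ R) : cutoff R x = 1 := by
  rw [cutoff, min_eq_left (by linarith), max_eq_right zero_le_one]

lemma cutoff_eq_zero {R : ℝ} {x : E} (h : R + 1 ≤ ‖x‖) : cutoff R x = 0 :=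
  max_eq_left ((min_le_right _ _).trans (by linarith))

lemma lipschitzWith_cutoff (R : ℝ) : LipschitzWith 1 (cutoff R : E → ℝ) := by
  have h : LipschitzWith 1 fun x : E => R + 1 - ‖x‖ := by
    refine LipschitzWith.of_dist_le_mul fun x y => ?_
    rw [Real.dist_eq, dist_eq_norm, NNReal.coe_one, one_mul]
    have := abs_norm_sub_norm_le y x
    rw [norm_sub_rev] at this
    convert this using 2
    ring
  exact (h.const_min 1).const_max 0

variable [NormedAddCommGroup F] [NormedSpace ℝ F]

/-- Cutting off a locally Lipschitz vector field makes it globally Lipschitz. -/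
lemma exists_lipschitzWith_cutoff_smul [ProperSpace E] {X : E → F} (hX : LocallyLipschitz X)
    (R : ℝ) : ∃ K, LipschitzWith K fun x => cutoff R x • X x := by
  obtain ⟨K, hK⟩ := (hX.locallyLipschitzOn (s := Metric.closedBall 0 (R + 1)))
    |>.exists_lipschitzOnWith_of_compact (isCompact_closedBall 0 (R + 1))
  obtain ⟨B, hB⟩ := (isCompact_closedBall (0 : E) (R + 1)).exists_bound_of_continuousOn
    hX.continuous.continuousOn
  have hB' : ∀ x ∈ Metric.closedBall (0 : E) (R + 1), ‖X x‖ ≤ max B 0 := fun x hx =>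
    (hB x hx).trans (le_max_left _ _)
  have hmem : ∀ x : E, x ∈ Metric.closedBall (0 : E) (R + 1) ↔ ‖x‖ ≤ R + 1 := fun x => by simp
  have hcut : ∀ x y : E, |cutoff R x - cutoff R y| ≤ ‖x - y‖ := fun x y => by
    have := (lipschitzWith_cutoff (E := E) R).dist_le_mul x y
    rwa [Real.dist_eq, dist_eq_norm, NNReal.coe_one, one_mul] at this
  refine ⟨K + Real.toNNReal (max B 0), LipschitzWith.of_dist_le_mul fun x y => ?_⟩
  -- If both points are outside the ball, both values vanish; if only one is, it may be called `y`.
  wlog hx : ‖x‖ ≤ R + 1 generalizing x y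
  · by_cases hy : ‖y‖ ≤ R + 1
    · rw [dist_comm, dist_comm x y]
      exact this y x hy
    · rw [cutoff_eq_zero (not_le.1 hx).le, cutoff_eq_zero (not_le.1 hy).le]
      simp only [zero_smul, dist_self]
      positivity
  push_cast
  rw [Real.coe_toNNReal _ (le_max_right _ _), dist_eq_norm, dist_eq_norm]
  have h1 : ‖(cutoff R x - cutoff R y) • X x‖ ≤ max B 0 * ‖x - y‖ := by
    rw [norm_smul, Real.norm_eq_abs, mul_comm]
    exact mul_le_mul (hB' x ((hmem x).2 hx)) (hcut x y) (abs_nonneg _) (le_max_right _ _)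
  by_cases hy : ‖y‖ ≤ R + 1
  · have h2 : ‖cutoff R y • (X x - X y)‖ ≤ K * ‖x - y‖ := by
      rw [norm_smul, Real.norm_eq_abs, abs_of_nonneg (cutoff_nonneg R y)]
      have h3 := hK.dist_le_mul x ((hmem x).2 hx) y ((hmem y).2 hy)
      rw [dist_eq_norm, dist_eq_norm] at h3
      have h4 := mul_le_mul (cutoff_le_one R y) h3 (norm_nonneg _) zero_le_one
      rwa [one_mul] at h4
    have h3 : cutoff R x • X x - cutoff R y • X y
        = (cutoff R x - cutoff R y) • X x + cutoff R y • (X x - X y) := by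
      rw [sub_smul, smul_sub]
      abel
    rw [h3, add_mul]
    exact (norm_add_le _ _).trans (by linarith)
  · have h3 : cutoff R x • X x - cutoff R y • X y = (cutoff R x - cutoff R y) • X x := by
      rw [cutoff_eq_zero (not_le.1 hy).le, sub_zero, zero_smul, sub_zero]
    rw [h3, add_mul]
    have : 0 ≤ K * ‖x - y‖ := by positivity
    linarith

end Lipschitz

/-! ### Existence of closed-loop solutions -/

section ClosedLoop

variable {N : ℕ} {f : Fin N → EuclideanSpace ℝ (Fin N) → ℝ}

lemma lipschitzWith_ownGrad (hf : SmoothLipschitz f) (i : Fin N) :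
    ∃ K, LipschitzWith K (ownGrad f i) := by
  obtain ⟨l, hl, h⟩ := (hf i).2
  refine ⟨Real.toNNReal l, LipschitzWith.of_dist_le_mul fun y z => ?_⟩
  rw [Real.coe_toNNReal _ hl.le, Real.dist_eq, dist_eq_norm]
  exact h y z

lemma contDiff_xi (a : Matrix (Fin N) (Fin N) ℝ) (i j : Fin N) :
    ContDiff ℝ 1 fun s : EstState N => s.xi a i j := by
  unfold EstState.xi consensus groundedLap EstState.err
  fun_prop

lemma locallyLipschitz_estField (hf : SmoothLipschitz f) (a : Matrix (Fin N) (Fin N) ℝ) :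
    LocallyLipschitz (estField f a) := by
  have hc : ∀ i j, ContDiff ℝ 1 fun s : EstState N => s.2.2 i j := fun i j => by fun_prop
  have h1 : LocallyLipschitz fun s : EstState N => (estField f a s).1 := by
    refine locallyLipschitz_pi fun j => ?_
    obtain ⟨K, hK⟩ := lipschitzWith_ownGrad hf j
    have : ContDiff ℝ 1 fun s : EstState N => s.2.1 j := by fun_prop
    exact hK.locallyLipschitz.comp this.locallyLipschitz
  have h2 : LocallyLipschitz fun s : EstState N => (estField f a s).2.1 := by
    refine locallyLipschitz_pi fun i => ?_
    have h : ContDiff ℝ 1 fun (s : EstState N) (j : Fin N) => -(s.2.2 i j * s.xi a i j) :=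
      contDiff_pi.2 fun j => ((hc i j).mul (contDiff_xi a i j)).neg
    have h' : ContDiff ℝ 1 fun s : EstState N =>
        (WithLp.toLp 2 fun j => -(s.2.2 i j * s.xi a i j) : EuclideanSpace ℝ (Fin N)) :=
      PiLp.contDiff_toLp.comp h
    exact h'.locallyLipschitz
  have h3 : LocallyLipschitz fun s : EstState N => (estField f a s).2.2 :=
    locallyLipschitz_pi fun i => locallyLipschitz_pi fun j =>
      ((contDiff_xi a i j).pow 2).locallyLipschitz
  exact h1.prodMk (h2.prodMk h3)

/-- The right-hand side of one integrator chain under the saturated control. -/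
noncomputable def chainField {m : ℕ} (hm : 1 < m) (θ Δ : ℝ) (x : Fin m → ℝ) (w : ℝ) :
    Fin m → ℝ :=
  (chainA m).mulVec x + satControl hm θ Δ ((transT m θ)⁻¹.mulVec x) w • chainB m

/-- Saturations are Lipschitz, so the chains need no cutoff. -/
lemma lipschitzWith_chainField {m : Fin N → ℕ} (hm : ∀ i, 1 < m i) {θ Δ : Fin N → ℝ}
    (hΔ : ∀ i, 0 < Δ i) :
    ∃ K, LipschitzWith K fun p : EstState N × ((i : Fin N) → Fin (m i) → ℝ) =>
      fun i => chainField (hm i) (θ i) (Δ i) (p.2 i) (p.1.1 i) := by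
  refine exists_lipschitzWith_pi fun i => exists_lipschitzWith_pi fun k => ?_
  have hx : ∀ l : Fin (m i), ∃ K, LipschitzWith K
      fun p : EstState N × ((i : Fin N) → Fin (m i) → ℝ) => p.2 i l := fun l =>
    ⟨1, LipschitzWith.of_dist_le_mul fun p q => by
      rw [NNReal.coe_one, one_mul]
      exact (dist_le_pi_dist (p.2 i) (q.2 i) l).trans
        ((dist_le_pi_dist p.2 q.2 i).trans (le_max_right _ _))⟩
  have hw : ∃ K, LipschitzWith K
      fun p : EstState N × ((i : Fin N) → Fin (m i) → ℝ) => p.1.1 i :=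
    ⟨1, LipschitzWith.of_dist_le_mul fun p q => by
      rw [NNReal.coe_one, one_mul]
      exact (dist_le_pi_dist p.1.1 q.1.1 i).trans
        ((le_max_left _ _).trans (le_max_left _ _))⟩
  have hmul : ∀ (M : Matrix (Fin (m i)) (Fin (m i)) ℝ) (l : Fin (m i)), ∃ K, LipschitzWith K
      fun p : EstState N × ((i : Fin N) → Fin (m i) → ℝ) => M.mulVec (p.2 i) l := fun M l =>
    exists_lipschitzWith_sum Finset.univ fun r => exists_lipschitzWith_const_mul (M l r) (hx r)
  have harg : ∀ l : Fin (m i), ∃ K, LipschitzWith K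
      fun p : EstState N × ((i : Fin N) → Fin (m i) → ℝ) =>
        satArg (θ i) ((transT (m i) (θ i))⁻¹.mulVec (p.2 i)) (p.1.1 i) l := fun l => by
    simp only [satArg]
    refine exists_lipschitzWith_add (hmul _ l) ?_
    split_ifs
    · exact exists_lipschitzWith_const_mul _ hw
    · exact ⟨0, LipschitzWith.const 0⟩
  have hu : ∃ K, LipschitzWith K fun p : EstState N × ((i : Fin N) → Fin (m i) → ℝ) =>
      satControl (hm i) (θ i) (Δ i) ((transT (m i) (θ i))⁻¹.mulVec (p.2 i)) (p.1.1 i) := by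
    simp only [satControl_eq, ← neg_one_mul (∑ k, _)]
    refine exists_lipschitzWith_const_mul _ (exists_lipschitzWith_sum _ fun l =>
      exists_lipschitzWith_const_mul _ ?_)
    obtain ⟨K, hK⟩ := harg l
    exact ⟨1 * K, (lipschitzWith_sat (hΔ i)).comp hK⟩
  simp only [chainField, Pi.add_apply, Pi.smul_apply, smul_eq_mul, mul_comm _ (chainB (m i) k)]
  exact exists_lipschitzWith_add (hmul _ k) (exists_lipschitzWith_const_mul _ hu)

variable {a : Matrix (Fin N) (Fin N) ℝ}

/-- The common term `w j` cancels in the differences of errors. -/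
lemma xi_eq_estState_xi {m : Fin N → ℕ} (p : Trajectory N m) (i j : Fin N) (t : ℝ) :
    p.xi f a i j t
      = EstState.xi a (fun j => p.gradInt f j t, fun i => p.z i t, fun i j => p.c i j t) i j := by
  simp only [Trajectory.xi, EstState.xi, consensus, groundedLap, EstState.err,
    add_sub_add_right_eq_sub]

lemma lyap_antitone {ys : EuclideanSpace ℝ (Fin N)} {g : ℝ} {s : ℝ → EstState N} {V' : ℝ → ℝ}
    (hV : ∀ t, 0 ≤ t → HasDerivWithinAt (fun t => lyap a ys g (s t)) (V' t) (Ici 0) t)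
    (hV' : ∀ t, 0 ≤ t → V' t ≤ 0) {t : ℝ} (ht : 0 ≤ t) :
    lyap a ys g (s t) ≤ lyap a ys g (s 0) := by
  have := sub_le_of_deriv_le hV le_rfl ht (C := 0) (fun r hr => hV' r hr.1)
  linarith

/-- The constructed solution carries `w` as a state variable; this identifies it with the integral
in the controller. -/
lemma gradInt_eq {m : Fin N → ℕ} {p : Trajectory N m} {w : ℝ → ℝ} {i : Fin N}
    (hF : Continuous (ownGrad f i)) (hz : ContinuousOn (p.z i) (Ici 0)) (hw0 : w 0 = 0)
    (hw : ∀ t, 0 ≤ t → HasDerivWithinAt w (ownGrad f i (p.z i t)) (Ici 0) t) {t : ℝ}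
    (ht : 0 ≤ t) : p.gradInt f i t = w t := by
  have hc : ContinuousOn (fun τ => ownGrad f i (p.z i τ)) (Ici 0) := hF.comp_continuousOn hz
  have h := intervalIntegral.integral_eq_sub_of_hasDeriv_right_of_le (f := w) ht
    (fun r hr => (hw r hr.1).continuousWithinAt.mono Icc_subset_Ici_self)
    (fun r hr => (hw r hr.1.le).mono fun q hq => hr.1.le.trans (le_of_lt hq))
    ((hc.mono Icc_subset_Ici_self).intervalIntegrable_of_Icc ht)
  rw [hw0, sub_zero] at h
  exact h

/-- The closed loop has a solution on `[0, ∞)` for all initial values. -/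
theorem exists_isSolution (hN : 1 < N) {m : Fin N → ℕ} (hm : ∀ i, 1 < m i)
    (hf : SmoothLipschitz f) (hmono : StronglyMonotone f)
    {G : SimpleGraph (Fin N)} (hG : G.Connected) (ha : IsWeightedAdjacency G a)
    (θ : Fin N → ℝ) {Δ : Fin N → ℝ} (hΔ : ∀ i, 0 < Δ i)
    {ys : EuclideanSpace ℝ (Fin N)} (hys : ∀ i, ownGrad f i ys = 0)
    (x₀ : (i : Fin N) → Fin (m i) → ℝ) (z₀ : Fin N → EuclideanSpace ℝ (Fin N))
    (c₀ : Fin N → Fin N → ℝ) (hc₀ : ∀ i j, 0 < c₀ i j) :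
    ∃ p : Trajectory N m, p.IsSolution hm f a θ Δ ∧
      (∀ i, p.x i 0 = x₀ i) ∧ (∀ i, p.z i 0 = z₀ i) ∧ ∀ i j, p.c i j 0 = c₀ i j := by
  obtain ⟨g, κ, hκ, hlyap⟩ := exists_lyapDeriv_le hN hf hmono hG ha hys
  -- The integral is empty at time zero, hence the first component.
  set s₀ : EstState N := (0, z₀, c₀) with hs₀
  obtain ⟨R, hR⟩ := exists_norm_le_of_lyap_le hN hG ha ys g (lyap a ys g s₀)
  obtain ⟨K₁, hK₁⟩ := exists_lipschitzWith_cutoff_smul (locallyLipschitz_estField hf a) R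
  obtain ⟨K₂, hK₂⟩ := lipschitzWith_chainField hm (θ := θ) hΔ
  have hfield := (hK₁.comp LipschitzWith.prod_fst).prodMk hK₂
  obtain ⟨γ, hγ0, hγ⟩ := exists_global_solution hfield (s₀, x₀)
  set s : ℝ → EstState N := fun t => (γ t).1 with hs
  have hs' : ∀ t, 0 ≤ t →
      HasDerivWithinAt s (cutoff R (s t) • estField f a (s t)) (Ici 0) t := fun t ht =>
    (ContinuousLinearMap.fst ℝ (EstState N) ((i : Fin N) → Fin (m i) → ℝ)).hasFDerivAt
      |>.comp_hasDerivWithinAt t (hγ t ht)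
  have hx' : ∀ t, 0 ≤ t → HasDerivWithinAt (fun t => (γ t).2)
      (fun i => chainField (hm i) (θ i) (Δ i) ((γ t).2 i) ((s t).1 i)) (Ici 0) t := fun t ht =>
    (ContinuousLinearMap.snd ℝ (EstState N) ((i : Fin N) → Fin (m i) → ℝ)).hasFDerivAt
      |>.comp_hasDerivWithinAt t (hγ t ht)
  have hs2' : ∀ t, 0 ≤ t → HasDerivWithinAt (fun t => (s t).2)
      (cutoff R (s t) • estField f a (s t)).2 (Ici 0) t := fun t ht =>
    (ContinuousLinearMap.snd ℝ (Fin N → ℝ) ((Fin N → EuclideanSpace ℝ (Fin N)) ×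
      (Fin N → Fin N → ℝ))).hasFDerivAt.comp_hasDerivWithinAt t (hs' t ht)
  have hw' : ∀ t, 0 ≤ t → ∀ j, HasDerivWithinAt (fun t => (s t).1 j)
      (cutoff R (s t) * ownGrad f j ((s t).2.1 j)) (Ici 0) t := by
    intro t ht
    have h : HasDerivWithinAt (fun t => (s t).1)
        (cutoff R (s t) • estField f a (s t)).1 (Ici 0) t :=
      (ContinuousLinearMap.fst ℝ (Fin N → ℝ) ((Fin N → EuclideanSpace ℝ (Fin N)) ×
        (Fin N → Fin N → ℝ))).hasFDerivAt.comp_hasDerivWithinAt t (hs' t ht)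
    exact hasDerivWithinAt_pi.1 h
  have hz' : ∀ t, 0 ≤ t → ∀ i j, HasDerivWithinAt (fun t => (s t).2.1 i j)
      (cutoff R (s t) * -((s t).2.2 i j * (s t).xi a i j)) (Ici 0) t := by
    intro t ht i j
    have h : HasDerivWithinAt (fun t => (s t).2.1)
        (cutoff R (s t) • estField f a (s t)).2.1 (Ici 0) t :=
      (ContinuousLinearMap.fst ℝ (Fin N → EuclideanSpace ℝ (Fin N))
        (Fin N → Fin N → ℝ)).hasFDerivAt.comp_hasDerivWithinAt t (hs2' t ht)
    exact (EuclideanSpace.proj j : EuclideanSpace ℝ (Fin N) →L[ℝ] ℝ).hasFDerivAt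
      |>.comp_hasDerivWithinAt t (hasDerivWithinAt_pi.1 h i)
  have hc' : ∀ t, 0 ≤ t → ∀ i j, HasDerivWithinAt (fun t => (s t).2.2 i j)
      (cutoff R (s t) * (s t).xi a i j ^ 2) (Ici 0) t := by
    intro t ht i j
    have h : HasDerivWithinAt (fun t => (s t).2.2)
        (cutoff R (s t) • estField f a (s t)).2.2 (Ici 0) t :=
      (ContinuousLinearMap.snd ℝ (Fin N → EuclideanSpace ℝ (Fin N))
        (Fin N → Fin N → ℝ)).hasFDerivAt.comp_hasDerivWithinAt t (hs2' t ht)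
    exact hasDerivWithinAt_pi.1 (hasDerivWithinAt_pi.1 h i) j
  have hs0 : s 0 = s₀ := by simp only [hs, hγ0]
  -- The cutoff factor is nonnegative, so the Lyapunov function is nonincreasing along the modified
  -- flow too, and the state stays where the factor is one.
  have hbound : ∀ t, 0 ≤ t → ‖s t‖ ≤ R := by
    intro t ht
    refine hR _ ?_
    rw [← hs0]
    refine lyap_antitone (s := s) (fun t ht => hasDerivWithinAt_lyap (f := f) ha.symm ys g
      (hw' t ht) (hz' t ht) (hc' t ht)) (fun t ht => ?_) ht
    refine mul_nonpos_of_nonneg_of_nonpos (cutoff_nonneg _ _) ((hlyap (s t)).trans ?_)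
    have h1 : 0 ≤ ∑ j, ((s t).1 j + ys j) ^ 2 := Finset.sum_nonneg fun j _ => sq_nonneg _
    have h2 : 0 ≤ ∑ i, ∑ j, (s t).xi a i j ^ 2 :=
      Finset.sum_nonneg fun i _ => Finset.sum_nonneg fun j _ => sq_nonneg _
    have := mul_nonneg hκ.le (add_nonneg h1 h2)
    linarith
  have hcut : ∀ t, 0 ≤ t → cutoff R (s t) = 1 := fun t ht => cutoff_eq_one (hbound t ht)
  set p : Trajectory N m := ⟨fun i t => (γ t).2 i, fun i t => (s t).2.1 i,
    fun i j t => (s t).2.2 i j⟩ with hp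
  have hgrad : ∀ i t, 0 ≤ t → p.gradInt f i t = (s t).1 i := by
    intro i t ht
    obtain ⟨K, hK⟩ := lipschitzWith_ownGrad hf i
    refine gradInt_eq (w := fun t => (s t).1 i) hK.continuous ?_ ?_ ?_ ht
    · have hcs : ContinuousOn s (Ici 0) := fun t ht => (hs' t ht).continuousWithinAt
      have : Continuous fun s : EstState N => s.2.1 i := by fun_prop
      exact this.comp_continuousOn hcs
    · simp only [hs0, hs₀]
      rfl
    · intro t ht
      have := hw' t ht i
      rwa [hcut t ht, one_mul] at this
  have hxi : ∀ i j t, 0 ≤ t → p.xi f a i j t = (s t).xi a i j := by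
    intro i j t ht
    rw [xi_eq_estState_xi]
    congr 1
    have : (fun j => p.gradInt f j t) = (s t).1 := funext fun j => hgrad j t ht
    rw [this]
  refine ⟨p, ⟨fun i t ht => ?_, fun i j t ht => ?_, fun i j t ht => ?_, fun i j => ?_⟩,
    fun i => ?_, fun i => ?_, fun i j => ?_⟩
  · have := hasDerivWithinAt_pi.1 (hx' t ht) i
    rw [Trajectory.u, hgrad i t ht]
    exact this
  · have := hz' t ht i j
    rw [hcut t ht, one_mul] at this
    rw [hxi i j t ht]
    exact this
  · have := hc' t ht i j
    rw [hcut t ht, one_mul] at this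
    rw [hxi i j t ht]
    exact this
  · simp only [hp, hs0, hs₀]
    exact hc₀ i j
  · simp only [hp, hγ0]
  · simp only [hp, hs0, hs₀]
  · simp only [hp, hs0, hs₀]

end ClosedLoop

/-! ### Convergence of the closed loop -/

section Convergence

variable {N : ℕ} {m : Fin N → ℕ} {f : Fin N → EuclideanSpace ℝ (Fin N) → ℝ}
  {a : Matrix (Fin N) (Fin N) ℝ} {p : Trajectory N m}

/-- The estimator state along a trajectory. -/
noncomputable def Trajectory.est (p : Trajectory N m)
    (f : Fin N → EuclideanSpace ℝ (Fin N) → ℝ) (t : ℝ) : EstState N :=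
  (fun j => p.gradInt f j t, fun i => p.z i t, fun i j => p.c i j t)

lemma continuousOn_toEuclidean {z : ℝ → EuclideanSpace ℝ (Fin N)} {S : Set ℝ}
    (h : ∀ j, ContinuousOn (fun t => z t j) S) : ContinuousOn z S := by
  have h1 : ContinuousOn (fun t => (WithLp.toLp 2 fun j => z t j : EuclideanSpace ℝ (Fin N))) S :=
    (PiLp.continuous_toLp 2 _).comp_continuousOn (continuousOn_pi.2 h)
  exact h1

lemma hasDerivWithinAt_gradInt {i : Fin N} (hF : Continuous (ownGrad f i))
    (hz : ContinuousOn (p.z i) (Ici 0)) {t : ℝ} (ht : 0 ≤ t) :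
    HasDerivWithinAt (p.gradInt f i) (ownGrad f i (p.z i t)) (Ici 0) t := by
  -- Trajectories are arbitrary for negative times; freezing `z` there gives a continuous integrand
  -- on the whole line.
  set h : ℝ → ℝ := fun τ => ownGrad f i (p.z i (max 0 τ)) with hh
  have hcont : Continuous h := by
    refine hF.comp ?_
    have : Continuous fun τ : ℝ => max 0 τ := by fun_prop
    exact hz.comp_continuous this fun τ => le_max_left 0 τ
  have h1 : HasDerivAt (fun t => ∫ τ in (0 : ℝ)..t, h τ) (h t) t :=
    (hcont.integral_hasStrictDerivAt 0 t).hasDerivAt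
  have h2 : ∀ r ∈ Ici (0 : ℝ), p.gradInt f i r = ∫ τ in (0 : ℝ)..r, h τ := by
    intro r hr
    refine intervalIntegral.integral_congr fun τ hτ => ?_
    rw [uIcc_of_le hr] at hτ
    simp only [hh, max_eq_right hτ.1]
  have h3 : h t = ownGrad f i (p.z i t) := by simp only [hh, max_eq_right ht]
  rw [← h3]
  exact h1.hasDerivWithinAt.congr h2 (h2 t ht)

/-- Convergence of the estimator, with boundedness of all its variables. -/
theorem estimator_convergence (hN : 1 < N) (hm : ∀ i, 1 < m i)
    (hf : SmoothLipschitz f) (hmono : StronglyMonotone f)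
    {G : SimpleGraph (Fin N)} (hG : G.Connected) (ha : IsWeightedAdjacency G a)
    {θ Δ : Fin N → ℝ} {ys : EuclideanSpace ℝ (Fin N)} (hys : ∀ i, ownGrad f i ys = 0)
    (hp : p.IsSolution hm f a θ Δ) :
    (∀ i t, 0 ≤ t → HasDerivWithinAt (p.gradInt f i) (ownGrad f i (p.z i t)) (Ici 0) t) ∧
      (∀ i, Tendsto (p.gradInt f i) atTop (𝓝 (-ys i))) ∧
      (∀ i, Tendsto (fun t => ownGrad f i (p.z i t)) atTop (𝓝 0)) ∧
      ∀ Φ : EstState N → ℝ, Continuous Φ → BoundedInTime fun t => Φ (p.est f t) := by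
  have hFc : ∀ i, Continuous (ownGrad f i) := fun i => by
    obtain ⟨K, hK⟩ := lipschitzWith_ownGrad hf i
    exact hK.continuous
  have hzc : ∀ i, ContinuousOn (p.z i) (Ici 0) := fun i =>
    continuousOn_toEuclidean fun j t ht => (hp.estimate i j t ht).continuousWithinAt
  have hw : ∀ i t, 0 ≤ t →
      HasDerivWithinAt (p.gradInt f i) (ownGrad f i (p.z i t)) (Ici 0) t := fun i t ht =>
    hasDerivWithinAt_gradInt (hFc i) (hzc i) ht
  have hz : ∀ i j t, 0 ≤ t → HasDerivWithinAt (fun t => p.z i t j)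
      (-(p.c i j t * (p.est f t).xi a i j)) (Ici 0) t := fun i j t ht => by
    have := hp.estimate i j t ht
    rwa [xi_eq_estState_xi] at this
  have hc : ∀ i j t, 0 ≤ t → HasDerivWithinAt (p.c i j)
      ((p.est f t).xi a i j ^ 2) (Ici 0) t := fun i j t ht => by
    have := hp.gain i j t ht
    rwa [xi_eq_estState_xi] at this
  obtain ⟨g, κ, hκ, hlyap⟩ := exists_lyapDeriv_le hN hf hmono hG ha hys
  have hV : ∀ t, 0 ≤ t → HasDerivWithinAt (fun t => lyap a ys g (p.est f t))
      (lyapDeriv f a ys g (p.est f t)) (Ici 0) t := fun t ht => by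
    have := hasDerivWithinAt_lyap (f := f) (s := p.est f) (χ := 1) (S := Ici 0) (t := t) ha.symm ys g
      (fun j => by rw [one_mul]; exact hw j t ht) (fun i j => by rw [one_mul]; exact hz i j t ht)
      (fun i j => by rw [one_mul]; exact hc i j t ht)
    rwa [one_mul] at this
  have hsq1 : ∀ s : EstState N, 0 ≤ ∑ j, (s.1 j + ys j) ^ 2 := fun s =>
    Finset.sum_nonneg fun j _ => sq_nonneg _
  have hsq2 : ∀ s : EstState N, 0 ≤ ∑ i, ∑ j, s.xi a i j ^ 2 := fun s =>
    Finset.sum_nonneg fun i _ => Finset.sum_nonneg fun j _ => sq_nonneg _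
  obtain ⟨R, hR⟩ := exists_norm_le_of_lyap_le hN hG ha ys g (lyap a ys g (p.est f 0))
  have hbound : ∀ t, 0 ≤ t → ‖p.est f t‖ ≤ R := fun t ht =>
    hR _ (lyap_antitone (s := p.est f) hV (fun t _ => (hlyap _).trans (by
      have := mul_nonneg hκ.le (add_nonneg (hsq1 (p.est f t)) (hsq2 (p.est f t)))
      linarith)) ht)
  -- The state stays in a compact ball. This also supplies the derivative bounds required by
  -- `tendsto_zero_of_dissipation`.
  have hbdd : ∀ Φ : EstState N → ℝ, Continuous Φ → BoundedInTime fun t => Φ (p.est f t) := by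
    intro Φ hΦ
    obtain ⟨B, hB⟩ := (isCompact_closedBall (0 : EstState N) R).exists_bound_of_continuousOn
      hΦ.continuousOn
    exact ⟨B, fun t ht => hB _ (by simpa using hbound t ht)⟩
  have hV0 : ∀ t, 0 ≤ t → 0 ≤ lyap a ys g (p.est f t) := fun t _ =>
    lyap_nonneg ha.symm ha.nonneg ys g _
  have hr : ∀ j, Tendsto (fun t => p.gradInt f j t + ys j) atTop (𝓝 0) := by
    intro j
    obtain ⟨M, hM⟩ := hbdd (fun s => ownGrad f j (s.2.1 j)) ((hFc j).comp (by fun_prop))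
    refine tendsto_zero_of_dissipation hV (fun t ht => (hw j t ht).add_const (ys j)) hV0 hκ
      (fun t _ => (hlyap _).trans (neg_le_neg (mul_le_mul_of_nonneg_left ?_ hκ.le))) hM
    have h1 := Finset.single_le_sum (f := fun j => ((p.est f t).1 j + ys j) ^ 2)
      (fun _ _ => sq_nonneg _) (Finset.mem_univ j)
    exact le_add_of_le_of_nonneg h1 (hsq2 _)
  have hxic : ∀ i j, Continuous fun s : EstState N => s.xi a i j := fun i j =>
    (contDiff_xi a i j).continuous
  have hξ : ∀ i j, Tendsto (fun t => (p.est f t).xi a i j) atTop (𝓝 0) := by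
    intro i j
    set e' : EstState N → Fin N → Fin N → ℝ := fun s i j =>
      -(s.2.2 i j * s.xi a i j) + ownGrad f j (s.2.1 j) with he'
    have he'c : ∀ i j, Continuous fun s => e' s i j := fun i j =>
      (Continuous.mul (by fun_prop) (hxic i j)).neg.add ((hFc j).comp (by fun_prop))
    have hcc : Continuous fun s => consensus a (e' s) i j := by
      simp only [consensus, groundedLap]
      exact (continuous_finsetSum _ fun k _ =>
        ((he'c i j).sub (he'c k j)).const_mul _).add ((he'c i j).const_mul _)
    obtain ⟨M, hM⟩ := hbdd _ hcc
    refine tendsto_zero_of_dissipation hV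
      (fun t ht => hasDerivWithinAt_consensus (e := fun i j t => (p.est f t).err i j)
        (e' := fun i j t => e' (p.est f t) i j)
        (fun i j => (hz i j t ht).fun_add (hw j t ht)) i j) hV0 hκ
      (fun t _ => (hlyap _).trans (neg_le_neg (mul_le_mul_of_nonneg_left ?_ hκ.le))) hM
    have h1 := Finset.single_le_sum (f := fun j => (p.est f t).xi a i j ^ 2)
      (fun _ _ => sq_nonneg _) (Finset.mem_univ j)
    have h2 := Finset.single_le_sum (f := fun i => ∑ j, (p.est f t).xi a i j ^ 2)
      (fun _ _ => Finset.sum_nonneg fun _ _ => sq_nonneg _) (Finset.mem_univ i)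
    exact le_add_of_nonneg_of_le (hsq1 _) (h1.trans h2)
  have hwlim : ∀ j, Tendsto (p.gradInt f j) atTop (𝓝 (-ys j)) := fun j => by
    simpa using (hr j).sub_const (ys j)
  obtain ⟨κ', hκ', herr⟩ := exists_error_sq_le hN hG ha
  have herrlim : ∀ i j, Tendsto (fun t => (p.est f t).err i j) atTop (𝓝 0) := by
    intro i j
    have h1 : Tendsto (fun t => κ' ^ 2 * ∑ i, ∑ j, (p.est f t).xi a i j ^ 2) atTop
        (𝓝 (κ' ^ 2 * ∑ _i : Fin N, ∑ _j : Fin N, 0 ^ 2)) :=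
      (tendsto_finsetSum _ fun i _ => tendsto_finsetSum _ fun j _ =>
        (hξ i j).pow 2).const_mul _
    have h0 : κ' ^ 2 * ∑ _i : Fin N, ∑ _j : Fin N, (0 : ℝ) ^ 2 = 0 := by simp
    rw [h0] at h1
    have h2 : Tendsto (fun t => (p.est f t).err i j ^ 2) atTop (𝓝 0) :=
      squeeze_zero (fun t => sq_nonneg _) (fun t => herr _ i j) h1
    have h3 := h2.sqrt
    simp only [Real.sqrt_sq_eq_abs, Real.sqrt_zero] at h3
    exact (tendsto_zero_iff_abs_tendsto_zero _).2 h3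
  have hzlim : ∀ i, Tendsto (p.z i) atTop (𝓝 ys) := by
    intro i
    have h1 : Tendsto (fun t (j : Fin N) => p.z i t j) atTop (𝓝 fun j => ys j) := by
      refine tendsto_pi_nhds.2 fun j => ?_
      have h2 := (herrlim i j).sub (hwlim j)
      simp only [EstState.err, Trajectory.est, add_sub_cancel_right, zero_sub, neg_neg] at h2
      exact h2
    exact ((PiLp.continuous_toLp 2 (fun _ : Fin N => ℝ)).tendsto (fun j => ys j)).comp h1
  refine ⟨hw, hwlim, fun i => ?_, hbdd⟩
  have := ((hFc i).tendsto ys).comp (hzlim i)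
  rwa [hys i] at this

/-- Convergence of the transformed state of an integrator chain driven by a convergent signal. -/
theorem chain_convergence {m : ℕ} (hm : 1 < m) {θ Δ : ℝ} (hθ0 : 0 < θ) (hθ : θ < 1 / 2)
    (hΔ : 0 < Δ) {x : ℝ → Fin m → ℝ} {w w' : ℝ → ℝ} {L : ℝ}
    (hx : ∀ t, 0 ≤ t → HasDerivWithinAt x (chainField hm θ Δ (x t) (w t)) (Ici 0) t)
    (hw : ∀ t, 0 ≤ t → HasDerivWithinAt w (w' t) (Ici 0) t)
    (hwL : Tendsto w atTop (𝓝 (-L))) (hw' : Tendsto w' atTop (𝓝 0)) :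
    Tendsto (fun t => (transT m θ)⁻¹.mulVec (x t)) atTop
      (𝓝 (L • (∏ i ∈ Finset.Icc 1 (m - 1), θ ^ i) • Pi.single ⟨0, zero_lt_one.trans hm⟩ 1)) := by
  set P := ∏ i ∈ Finset.Icc 1 (m - 1), θ ^ i with hP
  set xb : ℝ → Fin m → ℝ := fun t => (transT m θ)⁻¹.mulVec (x t) with hxb
  have hxb' : ∀ t, 0 ≤ t → HasDerivWithinAt xb
      ((barA m θ).mulVec (xb t) + satControl hm θ Δ (xb t) (w t) • barB m) (Ici 0) t := by
    intro t ht
    rw [← transT_inv_mulVec_dynamics hθ0 (zero_lt_one.trans hm)]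
    exact (Matrix.mulVecLin (transT m θ)⁻¹).toContinuousLinearMap.hasFDerivAt
      |>.comp_hasDerivWithinAt t (hx t ht)
  -- The shifted components satisfy the cascade; the derivative of the shift, `P * w'`, is its only
  -- disturbance and enters the first component.
  have hq := cascade_tendsto_zero (q := fun k t => satArg θ (xb t) (w t) k)
    (d := fun k t => if k.val = 0 then P * w' t else 0) hθ0 hθ hΔ (fun k t ht => by
      have h1 := hasDerivWithinAt_pi.1 (hxb' t ht) k
      have h2 : HasDerivWithinAt (fun t => if k.val = 0 then P * w t else 0)
          (if k.val = 0 then P * w' t else 0) (Ici 0) t := by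
        split_ifs
        · exact (hw t ht).const_mul P
        · exact hasDerivWithinAt_const t _ 0
      refine (h1.fun_add h2).congr_deriv ?_
      rw [Pi.add_apply, barA_mulVec_apply θ (xb t) (w t), satControl_eq, Pi.smul_apply, barB,
        smul_eq_mul, mul_one, sub_eq_add_neg]) (fun k => by
      split_ifs
      · simpa using hw'.const_mul P
      · exact tendsto_const_nhds)
  refine tendsto_pi_nhds.2 fun k => ?_
  have h2 : Tendsto (fun t => if k.val = 0 then P * w t else 0) atTop
      (𝓝 (if k.val = 0 then P * -L else 0)) := by
    split_ifs
    · exact hwL.const_mul P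
    · exact tendsto_const_nhds
  have h3 := (hq k).sub h2
  simp only [satArg, ← hP, add_sub_cancel_right, zero_sub] at h3
  convert h3 using 2
  by_cases hk : k.val = 0
  · have : k = ⟨0, zero_lt_one.trans hm⟩ := Fin.ext hk
    subst this
    simp
    ring
  · have : k ≠ ⟨0, zero_lt_one.trans hm⟩ := fun h => hk (by rw [h])
    simp [hk, this]

end Convergence

end NashSeeking

open NashSeeking in
theorem corollary2 (N : ℕ) (hN : 1 < N) (m : Fin N → ℕ) (hm : ∀ i, 1 < m i)
    (f : Fin N → EuclideanSpace ℝ (Fin N) → ℝ)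
    (hf : SmoothLipschitz f) (hmono : StronglyMonotone f)
    (G : SimpleGraph (Fin N)) (hG : G.Connected)
    (a : Matrix (Fin N) (Fin N) ℝ) (ha : IsWeightedAdjacency G a)
    (θ : Fin N → ℝ) (hθ : ∀ i, 0 < θ i ∧ θ i < 1 / 2)
    (Δ : Fin N → ℝ) (hΔ : ∀ i, 0 < Δ i) :
    ∃ ystar : EuclideanSpace ℝ (Fin N),
      IsNashEquilibrium f ystar ∧ (∀ y, IsNashEquilibrium f y → y = ystar) ∧
      (∀ (x₀ : (i : Fin N) → Fin (m i) → ℝ) (z₀ : Fin N → EuclideanSpace ℝ (Fin N))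
        (c₀ : Fin N → Fin N → ℝ), (∀ i j, 0 < c₀ i j) →
        ∃ p : Trajectory N m, p.IsSolution hm f a θ Δ ∧
          (∀ i, p.x i 0 = x₀ i) ∧ (∀ i, p.z i 0 = z₀ i) ∧ (∀ i j, p.c i j 0 = c₀ i j)) ∧
      ∀ p : Trajectory N m, p.IsSolution hm f a θ Δ →
        Tendsto (fun t => ‖p.y t - ystar‖) atTop (𝓝 0) ∧
        (∀ i k, BoundedInTime fun t => p.x i t k) ∧
        (∀ i k, BoundedInTime fun t => p.xbar θ i t k) ∧
        (∀ i j, BoundedInTime fun t => p.z i t j) ∧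
        (∀ i j, BoundedInTime fun t => p.c i j t) ∧
        (∀ i j, BoundedInTime fun t => p.xi f a i j t) ∧
        (∀ i, BoundedInTime fun t => p.gradInt f i t) ∧
        (∀ i, BoundedInTime fun t => p.u hm f θ Δ i t) := by
  obtain ⟨ys, hys⟩ := exists_ownGrad_eq_zero hf hmono
  refine ⟨ys, (isNashEquilibrium_iff hf hmono ys).2 hys, fun y hy =>
    eq_of_ownGrad_eq_zero hmono ((isNashEquilibrium_iff hf hmono y).1 hy) hys,
    exists_isSolution hN hm hf hmono hG ha θ hΔ hys, fun p hp => ?_⟩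
  obtain ⟨hw, hwlim, hglim, hbdd⟩ := estimator_convergence hN hm hf hmono hG ha hys hp
  have hm0 : ∀ i, 0 < m i := fun i => zero_lt_one.trans (hm i)
  have hxb : ∀ i, Tendsto (p.xbar θ i) atTop (𝓝 (ys i •
      (∏ k ∈ Finset.Icc 1 (m i - 1), θ i ^ k) • Pi.single ⟨0, hm0 i⟩ 1)) := fun i =>
    chain_convergence (hm i) (hθ i).1 (hθ i).2 (hΔ i) (hp.state i) (hw i) (hwlim i) (hglim i)
  have hx : ∀ i, Tendsto (p.x i) atTop (𝓝 (ys i • Pi.single ⟨0, hm0 i⟩ 1)) := by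
    intro i
    have h1 := ((Matrix.mulVecLin (transT (m i) (θ i))).toContinuousLinearMap.continuous.tendsto
      _).comp (hxb i)
    have h2 : (fun t => (transT (m i) (θ i)).mulVec (p.xbar θ i t)) = p.x i := by
      funext t
      rw [Trajectory.xbar, Matrix.mulVec_mulVec,
        Matrix.mul_nonsing_inv _ (isUnit_det_transT (hθ i).1), Matrix.one_mulVec]
    have h3 : (transT (m i) (θ i)).mulVec (ys i •
        (∏ k ∈ Finset.Icc 1 (m i - 1), θ i ^ k) • Pi.single ⟨0, hm0 i⟩ 1)
        = ys i • Pi.single ⟨0, hm0 i⟩ 1 := by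
      rw [Matrix.mulVec_smul, transT_mulVec_single (hθ i).1]
    rw [← h2, ← h3]
    exact h1
  have hxc : ∀ i, ContinuousOn (p.x i) (Set.Ici 0) := fun i t ht =>
    (hp.state i t ht).continuousWithinAt
  have hxbc : ∀ i, ContinuousOn (p.xbar θ i) (Set.Ici 0) := fun i =>
    (Matrix.mulVecLin (transT (m i) (θ i))⁻¹).toContinuousLinearMap.continuous.comp_continuousOn
      (hxc i)
  refine ⟨?_, fun i k => ?_, fun i k => ?_, fun i j => ?_, fun i j => ?_, fun i j => ?_,
    fun i => ?_, fun i => ?_⟩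
  · have h1 : Tendsto (fun t i => chainC (m i) ⬝ᵥ p.x i t) atTop (𝓝 fun i => ys i) := by
      refine tendsto_pi_nhds.2 fun i => ?_
      have h2 : Tendsto (fun t => chainC (m i) ⬝ᵥ p.x i t) atTop
          (𝓝 (chainC (m i) ⬝ᵥ (ys i • Pi.single ⟨0, hm0 i⟩ 1))) :=
        tendsto_finsetSum _ fun k _ => (tendsto_pi_nhds.1 (hx i) k).const_mul _
      simpa [chainC] using h2
    have h3 : Tendsto p.y atTop (𝓝 ys) :=
      ((PiLp.continuous_toLp 2 (fun _ : Fin N => ℝ)).tendsto (fun j => ys j)).comp h1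
    exact tendsto_iff_norm_sub_tendsto_zero.1 h3
  · exact boundedInTime_of_tendsto (continuousOn_pi.1 (hxc i) k) (tendsto_pi_nhds.1 (hx i) k)
  · exact boundedInTime_of_tendsto (continuousOn_pi.1 (hxbc i) k) (tendsto_pi_nhds.1 (hxb i) k)
  · exact hbdd (fun s => s.2.1 i j) (by fun_prop)
  · exact hbdd (fun s => s.2.2 i j) (by fun_prop)
  · simp only [xi_eq_estState_xi]
    exact hbdd (fun s => s.xi a i j) (contDiff_xi a i j).continuous
  · exact hbdd (fun s => s.1 i) (by fun_prop)
  -- The input is bounded a priori by its saturation levels.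
  · refine ⟨∑ k : Fin (m i), θ i ^ (m i - k.val) * Δ i, fun t _ => ?_⟩
    simp only [Trajectory.u, satControl_eq, abs_neg]
    refine (Finset.abs_sum_le_sum_abs _ _).trans (Finset.sum_le_sum fun k _ => ?_)
    have hpos : 0 ≤ θ i ^ (m i - k.val) := pow_nonneg (hθ i).1.le _
    rw [abs_mul, abs_of_nonneg hpos]
    exact mul_le_mul_of_nonneg_left (abs_sat_le (hΔ i) _) hpos
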